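/- Conventions. $C(\cdot)$ and $C(\cdot\mid\cdot)$ are plain unconditional and conditional Kolmogorov complexity of (tuples of) bit strings with respect to a fixed optimal description method; $I(a:b) := C(b)-C(b\mid a)$ and $I(a:b\mid c) := C(b\mid c)-C(b\mid a,c)$. We write $A\le^+B$ for $A\le B+O(\log N)$ and $A=^+B$ for $|A-B|\le O(\log N)$, where $N$ is the sum of the lengths of all strings involved (and $\log N$ stands for $\log_2(N+2)$). A bipartite graph $G=(L,R;E)$ has $1$-bounded common neighborhood on the right if any two distinct vertices of $R$ have at most one common neighbor in $L$. It is a good spectral bipartite expander if all vertices of $L$ have the same degree $D_L$, all vertices of $R$ have the same degree $D_R$, and the second largest eigenvalue (with multiplicity) of its $(|L|+|R|)\times(|L|+|R|)$ adjacency matrix is at most $\sqrt{\max\{D_L,D_R\}}$. Theorem. Let $(G_k)_{k\in\mathbb N}$ be an explicitly given family of finite bipartite graphs whose vertices are bit strings (an algorithm computes from $k$ the complete lists of vertices and edges of $G_k$). Let $G=(L,R;E)$ be a member $G_k$ of the family for which there is an integer $q$ with $k=\lfloor\log_2 q\rfloor$, $|L|=|R|=q^2$ and all vertex degrees in $G$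 equal to $q$ (for example, the incidence graph between the points and the non-vertical lines of the affine plane over the field with $q=2^k$ elements). Put $n:=\log_2 q$, and let $(x,y)\in E$ be a typical edge of $G$, i.e., $C(x)=^+2n$, $C(y)=^+2n$, $C(x,y)=^+3n$. (i) If $G$ has $1$-bounded common neighborhood on the right, then for all bit strings $w$ $$I(w:x,y)\le^+ 2I(w:x\mid y)+2I(w:y\mid x).$$ Moreover, for every $m$ and all $m$-bit strings $r_x,r_y$ with $C(x,y,r_x,r_y)=^+C(x,y)+C(r_x)+C(r_y)$, $$I(w:x,y,r_x,r_y)\le^+ 2I(w:x,r_x\mid y,r_y)+2I(w:y,r_y\mid x,r_x).$$ (ii) If $G$ is a good spectral bipartite expander, then for all bit strings $w$ with $C(w)\le n$ $$I(w:x,y)\le^+ I(w:x\mid y)+I(w:y\mid x).$$ Moreover, for every such $w$, every $m$ and all $m$-bit strings $r_x,r_y$ with $C(x,y,r_x,r_y)=^+C(x,y)+C(r_x)+C(r_y)$, $$I(w:x,y,r_x,r_y)\le^+ I(w:x,r_x\mid y,r_y)+I(w:y,r_y\mid x,r_x).$$ The constants hidden in the conclusions depend only on the optimal description method, on the family $(G_k)$,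 and on the constants hidden in the hypotheses (typicality and independence of $r_x,r_y$). -/

import Mathlib

/-! ### Kolmogorov complexity -/

/-- Bit strings. -/
abbrev Str := List Bool

/-- A description method: it takes a program (a bit string) and a finite tuple of bit strings
(the condition), and it may halt with a finite tuple of bit strings. -/
abbrev Machine := Str × List Str →. List Str

/-- `U` is an optimal (additively universal) description method: it is partial computable and, up
to an additive constant, its descriptions are at most as long as those of any other partial
computable method. -/
def IsOptimal (U : Machine) : Prop :=
  Partrec U ∧ ∀ V : Machine, Partrec V → ∃ c : ℕ, ∀ (p : Str) (xs ys : List Str),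
    xs ∈ V (p, ys) → ∃ p' : Str, p'.length ≤ p.length + c ∧ xs ∈ U (p', ys)

/-- `KC U xs ys` is the (plain, conditional) Kolmogorov complexity `C(xs | ys)` of the tuple `xs`
given the tuple `ys`. The set is nonempty when `U` is optimal. The unconditional complexity is
`C(xs | [])`. -/
noncomputable def KC (U : Machine) (xs ys : List Str) : ℕ :=
  sInf {k : ℕ | ∃ p : Str, p.length = k ∧ xs ∈ U (p, ys)}

/-- The information `I(ws : xs | zs) = C(xs | zs) - C(xs | ws, zs)` in `ws` on `xs` conditional
on `zs`. For `zs = []` it is the unconditional `I(ws : xs) = C(xs) - C(xs | ws)`. -/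
noncomputable def MI (U : Machine) (ws xs zs : List Str) : ℝ :=
  (KC U xs zs : ℝ) - (KC U xs (ws ++ zs) : ℝ)

/-- The sum of the lengths of the strings in a tuple. -/
def totalLength (ss : List Str) : ℕ := (ss.map List.length).sum

/-- The logarithmic term `log₂ (N + 2)`, where `N` is the sum of the lengths of the strings that
are involved; the shift by `2` makes it at least `1`. -/
noncomputable def logTerm (ss : List Str) : ℝ := Real.logb 2 ((totalLength ss : ℝ) + 2)

/-- `a = b` up to `t * log N`, where `N` is the total length of the strings `ss`. -/
def ApproxEq (t : ℝ) (ss : List Str) (a b : ℝ) : Prop := |a - b| ≤ t * logTerm ss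

/-- Optimal description methods exist. -/
theorem exists_isOptimal : ∃ U : Machine, IsOptimal U := by
  let U : Machine := fun a =>
    (Nat.Partrec.Code.eval (Denumerable.ofNat Nat.Partrec.Code (a.1.takeWhile id).length)
      (Encodable.encode ((a.1.dropWhile id).tail, a.2))).bind
        fun m => ((Encodable.decode m : Option (List Str)) : Part (List Str))
  refine ⟨U, ?_, ?_⟩
  · refine Partrec.bind (Nat.Partrec.Code.eval_part.comp ?_ ?_) ?_
    · exact (Computable.ofNat _).comp (Computable.list_length.comp
        ((Primrec.list_takeWhile Primrec.id).to_comp.comp Computable.fst))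
    · exact Computable.encode.comp (Computable.pair
        (Primrec.list_tail.to_comp.comp
          ((Primrec.list_dropWhile Primrec.id).to_comp.comp Computable.fst)) Computable.snd)
    · exact Computable.ofOption (Computable.decode.comp Computable.snd)
  · intro V hV
    obtain ⟨c, hc⟩ := Nat.Partrec.Code.exists_code.1 hV
    refine ⟨Encodable.encode c + 1, fun p xs ys h => ?_⟩
    refine ⟨List.replicate (Encodable.encode c) true ++ false :: p, by simp; omega, ?_⟩
    have h1 : (List.replicate (Encodable.encode c) true ++ false :: p).takeWhile id
        = List.replicate (Encodable.encode c) true := by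
      rw [List.takeWhile_append_of_pos (by simp)]; simp
    have h2 : (List.replicate (Encodable.encode c) true ++ false :: p).dropWhile id
        = false :: p := by
      rw [List.dropWhile_append_of_pos (by simp)]; simp
    simp only [U, h1, h2, List.length_replicate, Denumerable.ofNat_encode, List.tail_cons, hc]
    rw [Part.mem_bind_iff]
    refine ⟨Encodable.encode xs, ?_, by simp⟩
    simp only [Encodable.encodek, Part.coe_some, Part.bind_some]
    exact Part.mem_map _ h

/-! ### Bipartite graphs -/

/-- A finite bipartite graph `(L, R; E)` whose vertices are represented by bit strings. The two
sides are regarded as disjoint, even if the same string occurs on both sides. -/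
structure BipGraph where
  /-- left vertices -/
  L : Finset Str
  /-- right vertices -/
  R : Finset Str
  /-- edges -/
  E : Finset (Str × Str)
  edges_subset : E ⊆ L ×ˢ R

namespace BipGraph

/-- The neighbors (in `R`) of a left vertex. -/
def nbrOfLeft (H : BipGraph) (x : Str) : Finset Str := H.R.filter fun y => (x, y) ∈ H.E

/-- The neighbors (in `L`) of a right vertex. -/
def nbrOfRight (H : BipGraph) (y : Str) : Finset Str := H.L.filter fun x => (x, y) ∈ H.E

/-- All left vertices have degree `DL` and all right vertices have degree `DR`. -/
def IsBiregular (H : BipGraph) (DL DR : ℕ) : Prop :=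
  (∀ x ∈ H.L, (H.nbrOfLeft x).card = DL) ∧ (∀ y ∈ H.R, (H.nbrOfRight y).card = DR)

/-- The parameters of the incidence graph between the points of the plane over a field with `q`
elements and the polynomials of degree at most `d`: `|L| = q ^ 2`, `|R| = q ^ (d + 1)`, left
degrees `q ^ d`, right degrees `q`. -/
def HasParams (H : BipGraph) (q d : ℕ) : Prop :=
  H.L.card = q ^ 2 ∧ H.R.card = q ^ (d + 1) ∧ H.IsBiregular (q ^ d) q

/-- `d`-bounded common neighborhood on the right. -/
def BoundedCommonNbhd (H : BipGraph) (d : ℕ) : Prop :=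
  ∀ y₁ ∈ H.R, ∀ y₂ ∈ H.R, y₁ ≠ y₂ → (H.nbrOfRight y₁ ∩ H.nbrOfRight y₂).card ≤ d

/-- The `|L| × |R|` biadjacency matrix. -/
def biadjMatrix (H : BipGraph) : Matrix H.L H.R ℝ :=
  Matrix.of fun x y => if ((x : Str), (y : Str)) ∈ H.E then 1 else 0

/-- The adjacency matrix, of size `|L| + |R|`. -/
def adjMatrix (H : BipGraph) : Matrix (H.L ⊕ H.R) (H.L ⊕ H.R) ℝ :=
  Matrix.fromBlocks 0 H.biadjMatrix H.biadjMatrix.transpose 0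

theorem adjMatrix_isHermitian (H : BipGraph) : H.adjMatrix.IsHermitian := by
  unfold adjMatrix
  rw [Matrix.isHermitian_fromBlocks_iff]
  refine ⟨Matrix.isHermitian_zero, ?_, ?_, Matrix.isHermitian_zero⟩ <;>
    simp [Matrix.conjTranspose_eq_transpose_of_trivial]

/-- The second largest eigenvalue `λ₂` of the adjacency matrix, counted with multiplicity
(`eigenvalues₀` is the decreasing list of all eigenvalues, with indices from `0`). -/
noncomputable def secondEigenvalue (H : BipGraph) : ℝ :=
  if h : 1 < Fintype.card (H.L ⊕ H.R) then H.adjMatrix_isHermitian.eigenvalues₀ ⟨1, h⟩ else 0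

/-- Good spectral bipartite expanders: biregular with `λ₂ ≤ √(max (DL, DR))`. -/
def IsGoodExpander (H : BipGraph) : Prop :=
  ∃ DL DR : ℕ, H.IsBiregular DL DR ∧ H.secondEigenvalue ≤ √((max DL DR : ℕ) : ℝ)

/-- A family of graphs is given explicitly: an algorithm computes from `n` the complete lists of
the vertices and edges of the `n`-th graph. -/
def IsExplicit (G : ℕ → BipGraph) : Prop :=
  ∃ (l r : ℕ → List Str) (e : ℕ → List (Str × Str)),
    Computable l ∧ Computable r ∧ Computable e ∧
      ∀ n, (G n).L = (l n).toFinset ∧ (G n).R = (r n).toFinset ∧ (G n).E = (e n).toFinset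

/-- The edge `(x, y)` of a graph with parameters `q`, `d` is typical, with the constant `t` in the
logarithmic terms: `C(x) = 2 n`, `C(y) = (d + 1) n` and `C(x, y) = (d + 2) n` up to `t * log N`,
where `n = log₂ q`. -/
def IsTypicalEdge (U : Machine) (t : ℝ) (H : BipGraph) (q d : ℕ) (x y : Str) : Prop :=
  (x, y) ∈ H.E ∧
    ApproxEq t [x, y] (KC U [x] []) (2 * Real.logb 2 q) ∧
    ApproxEq t [x, y] (KC U [y] []) ((d + 1) * Real.logb 2 q) ∧
    ApproxEq t [x, y] (KC U [x, y] []) ((d + 2) * Real.logb 2 q)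

end BipGraph

/-- The strings `rx` and `ry` are independent of each other and of the pair `(x, y)`, with the
constant `t`: `C(x, y, rx, ry) = C(x, y) + C(rx) + C(ry)` up to `t * log N`. -/
def IndepStrings (U : Machine) (t : ℝ) (x y rx ry : Str) : Prop :=
  ApproxEq t [x, y, rx, ry] (KC U [x, y, rx, ry] [])
    ((KC U [x, y] [] : ℝ) + KC U [rx] [] + KC U [ry] [])

/-! All (in)equalities below are up to O(log N). Write a = C(x|w), b = C(y|w), e = C(x,y|w).
Typicality and the chain rule (`exists_KC_append_le`, `exists_le_KC_append`) turn I(w:x,y) into 3n -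
e, I(w:x|y) into n - e + b and I(w:y|x) into n - e + a. So (i) amounts to 3e ≤ n + 2a + 2b, and (ii)
to e + n ≤ a + b.

Both follow from counting edges. Let S be the set of left vertices of complexity at most a given w,
and T the set of right vertices of complexity at most b. Then |S| ≤ 2^(a+1) and |T| ≤ 2^(b+1). As
the graph is explicit, the edges F between S and T can be enumerated given w and O(log N) further
bits, so e ≤ log |F| (`exists_edge_sets`). Combinatorial bounds on |F| thus become bounds on e.

(i) Bounded common neighborhoods give |F|² ≤ |S|(|T|² + |F|) (`card_sq_le`), so e ≤ a or 2e ≤ a +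
2b. Each end of a typical edge determines the other up to n bits, so e ≤ a + n and e ≤ b + n; adding
the appropriate one finishes either case.

(ii) The expander mixing lemma gives |F| ≤ |S||T|/q + √(q|S||T|) (`card_le_of_isGoodExpander`), so e
+ n ≤ a + b or 2e ≤ n + a + b. Since C(w) ≤ n forces e ≥ 2n, the second alternative implies the
first.

For the additional strings, `exists_MI_le` bounds C(x,y,rx,ry|w) by e + C(rx|w,x) + C(ry|w,y). The
same conditional terms occur on the other side when C(y,ry|w) and C(x,rx|w) are expanded, and
independence of rx, ry handles the unconditional terms. The plain inequalities are the case of empty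
additional tuples. -/

/-! ### Enumeration of semidecidable sets -/

/-- A predicate is semidecidable if it is the projection of a computable predicate. -/
def SemiDec {α : Type*} [Primcodable α] (P : α → Prop) : Prop :=
  ∃ f : α → ℕ → Bool, Computable₂ f ∧ ∀ a, P a ↔ ∃ t, f a t = true

theorem SemiDec.of_iff {α : Type*} [Primcodable α] {P Q : α → Prop} (hP : SemiDec P)
    (h : ∀ a, Q a ↔ P a) : SemiDec Q := by
  obtain ⟨f, hf, hfP⟩ := hP
  exact ⟨f, hf, fun a => (h a).trans (hfP a)⟩

theorem SemiDec.comp {α β : Type*} [Primcodable α] [Primcodable β] {P : β → Prop}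
    (hP : SemiDec P) {g : α → β} (hg : Computable g) : SemiDec fun a => P (g a) := by
  obtain ⟨f, hf, hfP⟩ := hP
  exact ⟨fun a t => f (g a) t, hf.comp (hg.comp Computable.fst) Computable.snd,
    fun a => hfP (g a)⟩

theorem SemiDec.of_bool {α : Type*} [Primcodable α] {f : α → Bool} (hf : Computable f) :
    SemiDec fun a => f a = true :=
  ⟨fun a _ => f a, hf.comp Computable.fst, fun a => by simp⟩

theorem SemiDec.and {α : Type*} [Primcodable α] {P Q : α → Prop}
    (hP : SemiDec P) (hQ : SemiDec Q) : SemiDec fun a => P a ∧ Q a := by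
  obtain ⟨f, hf, hfP⟩ := hP
  obtain ⟨g, hg, hgQ⟩ := hQ
  have hu : Computable fun a : α × ℕ => a.2.unpair := Computable.unpair.comp Computable.snd
  refine ⟨fun a t => f a t.unpair.1 && g a t.unpair.2, ?_, fun a => ?_⟩
  · exact Primrec.and.to_comp.comp
      (hf.comp Computable.fst (Computable.fst.comp hu))
      (hg.comp Computable.fst (Computable.snd.comp hu))
  · dsimp only
    rw [hfP, hgQ]
    constructor
    · rintro ⟨⟨s, hs⟩, t, ht⟩
      exact ⟨Nat.pair s t, by simp [hs, ht]⟩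
    · rintro ⟨t, ht⟩
      rw [Bool.and_eq_true] at ht
      exact ⟨⟨_, ht.1⟩, _, ht.2⟩

theorem SemiDec.exists {α β : Type*} [Primcodable α] [Primcodable β] {P : α × β → Prop}
    (hP : SemiDec P) : SemiDec fun a => ∃ b, P (a, b) := by
  obtain ⟨f, hf, hfP⟩ := hP
  have hu : Computable fun a : α × ℕ => a.2.unpair := Computable.unpair.comp Computable.snd
  -- A stage codes a candidate witness together with a stage for it; codes of no witness count as
  -- failures.
  refine ⟨fun a t => ((Encodable.decode t.unpair.1 : Option β).map
    fun b => f (a, b) t.unpair.2).getD false, ?_, fun a => ?_⟩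
  · refine Computable.option_getD (Computable.option_map
      (Computable.decode.comp (Computable.fst.comp hu)) ?_) (Computable.const false)
    exact hf.comp (Computable.pair (Computable.fst.comp Computable.fst) Computable.snd)
      (Computable.snd.comp (hu.comp Computable.fst))
  · constructor
    · rintro ⟨b, hb⟩
      obtain ⟨t, ht⟩ := (hfP _).1 hb
      exact ⟨Nat.pair (Encodable.encode b) t, by simp [ht]⟩
    · rintro ⟨t, ht⟩
      cases hd : (Encodable.decode t.unpair.1 : Option β) with
      | none => simp [hd] at ht
      | some b => exact ⟨b, (hfP _).2 ⟨t.unpair.2, by simpa [hd] using ht⟩⟩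

theorem Partrec.semiDec_graph {α β : Type*} [Primcodable α] [Primcodable β] {F : α →. β}
    (hF : Partrec F) : SemiDec fun ab : α × β => ab.2 ∈ F ab.1 := by
  obtain ⟨c, hc⟩ := Nat.Partrec.Code.exists_code.1 hF
  refine ⟨fun ab t => decide (Nat.Partrec.Code.evaln t c (Encodable.encode ab.1)
    = some (Encodable.encode ab.2)), ?_, fun ab => ?_⟩
  · have h1 : Computable fun a : (α × β) × ℕ =>
        Nat.Partrec.Code.evaln a.2 c (Encodable.encode a.1.1) :=
      Nat.Partrec.Code.primrec_evaln.to_comp.comp (Computable.pair (Computable.pair Computable.snd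
        (Computable.const c)) (Computable.encode.comp (Computable.fst.comp Computable.fst)))
    have h2 : Computable fun a : (α × β) × ℕ => some (Encodable.encode a.1.2) :=
      Computable.option_some.comp (Computable.encode.comp (Computable.snd.comp Computable.fst))
    exact (Primrec.eq (α := Option ℕ)).decide.to_comp.comp h1 h2
  · simp only [decide_eq_true_eq]
    rw [show (∃ t, Nat.Partrec.Code.evaln t c (Encodable.encode ab.1)
      = some (Encodable.encode ab.2)) ↔ Encodable.encode ab.2 ∈ c.eval (Encodable.encode ab.1) from
      Nat.Partrec.Code.evaln_complete.symm, hc]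
    simp

/-- The list of the distinct values among the first `T` values of a partial enumeration, in the
order of their first appearance. -/
def distinctList {β : Type*} [DecidableEq β] (e : ℕ → Option β) (T : ℕ) : List β :=
  Nat.rec [] (fun n l => Option.casesOn (e n) l fun b => if b ∈ l then l else l ++ [b]) T

section distinctList

variable {β : Type*} [DecidableEq β] (e : ℕ → Option β)

theorem distinctList_succ (T : ℕ) : distinctList e (T + 1) =
    Option.casesOn (e T) (distinctList e T)
      fun b => if b ∈ distinctList e T then distinctList e T else distinctList e T ++ [b] := rfl

theorem distinctList_prefix {S T : ℕ} (h : S ≤ T) : distinctList e S <+: distinctList e T := by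
  induction T, h using Nat.le_induction with
  | base => exact List.prefix_rfl
  | succ T _ ih =>
    refine ih.trans ?_
    rw [distinctList_succ]
    cases e T with
    | none => exact List.prefix_rfl
    | some b =>
      dsimp only
      split_ifs
      · exact List.prefix_rfl
      · exact List.prefix_append _ _

theorem nodup_distinctList (T : ℕ) : (distinctList e T).Nodup := by
  induction T with
  | zero => exact List.nodup_nil
  | succ T ih =>
    rw [distinctList_succ]
    cases e T with
    | none => exact ih
    | some b =>
      dsimp only
      split_ifs with hb
      · exact ih
      · rw [List.nodup_append]
        exact ⟨ih, List.nodup_singleton _, by rintro a ha c hc rfl; simp_all⟩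

theorem mem_distinctList {T : ℕ} {b : β} : b ∈ distinctList e T ↔ ∃ t < T, e t = some b := by
  induction T with
  | zero => simp [distinctList]
  | succ T ih =>
    rw [distinctList_succ]
    simp only [Nat.lt_succ_iff_lt_or_eq, or_and_right, exists_or, exists_eq_left, ← ih]
    cases e T with
    | none => simp
    | some c =>
      dsimp only
      split_ifs with hc
      · simp only [Option.some.injEq]
        exact ⟨Or.inl, by rintro (h | rfl) <;> assumption⟩
      · simp [eq_comm]

end distinctList

theorem computable_decide_list_mem {β : Type*} [Primcodable β] [DecidableEq β] :
    Computable₂ fun (l : List β) (b : β) => decide (b ∈ l) := by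
  have h : PrimrecRel fun (l : List β) (b : β) => ∃ a ∈ l, a = b :=
    PrimrecRel.exists_mem_list Primrec.eq
  exact (h.decide.to_comp).of_eq fun p => by simp

theorem computable_distinctList {α β : Type*} [Primcodable α] [Primcodable β] [DecidableEq β]
    {e : α → ℕ → Option β} (he : Computable₂ e) : Computable₂ fun a T => distinctList (e a) T := by
  refine Computable.nat_rec (f := fun p : α × ℕ => p.2) (g := fun _ => ([] : List β))
    (h := fun p q => Option.casesOn (e p.1 q.1) q.2 fun b => if b ∈ q.2 then q.2 else q.2 ++ [b])
    Computable.snd (Computable.const []) ?_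
  refine Computable.option_casesOn
    (he.comp (Computable.fst.comp Computable.fst) (Computable.fst.comp Computable.snd))
    (Computable.snd.comp Computable.snd) ?_
  have hl : Computable fun r : ((α × ℕ) × ℕ × List β) × β => r.1.2.2 :=
    Computable.snd.comp (Computable.snd.comp Computable.fst)
  refine (Computable.cond (computable_decide_list_mem.comp hl Computable.snd) hl
    (Computable.list_concat.comp hl Computable.snd)).of_eq fun r => ?_
  simp [Bool.cond_decide]

/-- A semidecidable relation can be enumerated fibrewise, without repetitions. -/
theorem SemiDec.exists_enum {α β : Type*} [Primcodable α] [Primcodable β] [DecidableEq β]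
    {P : α × β → Prop} (hP : SemiDec P) :
    ∃ D : α → ℕ → List β, Computable₂ D ∧ (∀ a S T, S ≤ T → D a S <+: D a T) ∧
      (∀ a T, (D a T).Nodup) ∧ ∀ a b, P (a, b) ↔ ∃ T, b ∈ D a T := by
  obtain ⟨f, hf, hfP⟩ := hP
  have hu : Computable fun a : α × ℕ => a.2.unpair := Computable.unpair.comp Computable.snd
  let e : α → ℕ → Option β := fun a t => (Encodable.decode t.unpair.1 : Option β).bind
    fun b => bif f (a, b) t.unpair.2 then some b else none
  have he : Computable₂ e := by
    refine Computable.option_bind (Computable.decode.comp (Computable.fst.comp hu)) ?_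
    exact Computable.cond
      (hf.comp (Computable.pair (Computable.fst.comp Computable.fst) Computable.snd)
        (Computable.snd.comp (hu.comp Computable.fst)))
      (Computable.option_some.comp Computable.snd) (Computable.const none)
  refine ⟨fun a T => distinctList (e a) T, computable_distinctList he,
    fun a S T h => distinctList_prefix _ h, fun a T => nodup_distinctList _ T, fun a b => ?_⟩
  rw [hfP]
  simp only [mem_distinctList]
  constructor
  · rintro ⟨t, ht⟩
    exact ⟨_, Nat.pair (Encodable.encode b) t, Nat.lt_succ_self _, by simp [e, ht]⟩
  · rintro ⟨_, t, -, ht⟩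
    refine ⟨t.unpair.2, ?_⟩
    obtain ⟨b', -, hb⟩ := Option.bind_eq_some_iff.1 ht
    cases h : f (a, b') t.unpair.2 with
    | false => simp [h] at hb
    | true =>
      obtain rfl : b' = b := by simpa [h] using hb
      exact h

/-- The elements of a semidecidable relation are computed from their numbers in an enumeration. -/
theorem SemiDec.exists_partrec_index {α β : Type*} [Primcodable α] [Primcodable β] [DecidableEq β]
    {P : α × β → Prop} (hP : SemiDec P) :
    ∃ F : α × ℕ →. β, Partrec F ∧ ∀ (a : α) (b : β) (s : Finset β), P (a, b) →
      (∀ b', P (a, b') → b' ∈ s) → ∃ i < s.card, b ∈ F (a, i) := by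
  obtain ⟨D, hD, hmono, hnodup, hmem⟩ := hP.exists_enum
  refine ⟨fun p => Nat.rfindOpt fun T => (D p.1 T)[p.2]?, Partrec.rfindOpt ?_, ?_⟩
  · exact Computable.list_getElem?.comp
      (hD.comp (Computable.fst.comp Computable.fst) Computable.snd)
      (Computable.snd.comp Computable.fst)
  · intro a b s hb hs
    obtain ⟨T, hT⟩ := (hmem a b).1 hb
    obtain ⟨i, hi, rfl⟩ := List.getElem_of_mem hT
    refine ⟨i, ?_, ?_⟩
    -- The list has no repetitions, so its length, and hence the index, is bounded by the number of
    -- solutions.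
    · have h1 : (D a T).toFinset ⊆ s := fun c hc =>
        hs c ((hmem a c).2 ⟨T, List.mem_toFinset.1 hc⟩)
      calc i < (D a T).length := hi
        _ = (D a T).toFinset.card := (List.toFinset_card_of_nodup (hnodup a T)).symm
        _ ≤ s.card := Finset.card_le_card h1
    · dsimp only
      -- Later lists only extend earlier ones, so the entry at position `i` never changes once it is
      -- present and the search returns it.
      rw [Nat.rfindOpt_mono]
      · exact ⟨T, by simp [hi]⟩
      · intro c m n hmn hc
        rw [Option.mem_def] at hc ⊢
        obtain ⟨r, hr⟩ := hmono a m n hmn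
        rw [← hr, List.getElem?_append_left (List.getElem?_eq_some_iff.1 hc).1, hc]

/-- It is semidecidable whether a semidecidable relation has at least a given number of
solutions. -/
theorem SemiDec.card_ge {α β : Type*} [Primcodable α] [Primcodable β] [DecidableEq β]
    {P : α × β → Prop} (hP : SemiDec P) :
    SemiDec fun p : α × ℕ => ∃ s : Finset β, p.2 ≤ s.card ∧ ∀ b ∈ s, P (p.1, b) := by
  obtain ⟨D, hD, hmono, hnodup, hmem⟩ := hP.exists_enum
  refine ⟨fun p T => decide (p.2 ≤ (D p.1 T).length), ?_, fun p => ?_⟩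
  · exact Primrec.nat_le.decide.to_comp.comp (Computable.snd.comp Computable.fst)
      (Computable.list_length.comp (hD.comp (Computable.fst.comp Computable.fst) Computable.snd))
  · simp only [decide_eq_true_eq]
    constructor
    · rintro ⟨s, hs, hsP⟩
      have : ∃ T, ∀ b ∈ s, b ∈ D p.1 T := by
        clear hs
        induction s using Finset.induction_on with
        | empty => exact ⟨0, by simp⟩
        | insert b s _ ih =>
          obtain ⟨T, hT⟩ := ih fun c hc => hsP c (Finset.mem_insert_of_mem hc)
          obtain ⟨S, hS⟩ := (hmem _ _).1 (hsP b (Finset.mem_insert_self _ _))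
          refine ⟨max S T, fun c hc => ?_⟩
          rcases Finset.mem_insert.1 hc with rfl | hc
          · exact (hmono _ _ _ (le_max_left S T)).subset hS
          · exact (hmono _ _ _ (le_max_right S T)).subset (hT c hc)
      obtain ⟨T, hT⟩ := this
      refine ⟨T, hs.trans ?_⟩
      rw [← List.toFinset_card_of_nodup (hnodup p.1 T)]
      exact Finset.card_le_card fun b hb => List.mem_toFinset.2 (hT b hb)
    · rintro ⟨T, hT⟩
      refine ⟨(D p.1 T).toFinset, ?_, fun b hb => (hmem _ _).2 ⟨T, List.mem_toFinset.1 hb⟩⟩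
      rwa [List.toFinset_card_of_nodup (hnodup p.1 T)]

/-! ### Programs with a parameter -/

/-- The value of a bit string as a binary numeral, least significant bit first. -/
def bitsVal (l : Str) : ℕ := l.foldr (fun b n => cond b (2 * n + 1) (2 * n)) 0

theorem bitsVal_bits (n : ℕ) : bitsVal (Nat.bits n) = n := by
  induction n using Nat.binaryRec' with
  | zero => simp [bitsVal]
  | bit b n h ih =>
    rw [Nat.bits_append_bit _ _ h]
    simp only [bitsVal, List.foldr_cons] at ih ⊢
    rw [ih]
    cases b <;> simp [Nat.bit]

theorem computable_bitsVal : Computable bitsVal := by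
  refine (Primrec.list_foldr (f := fun l : Str => l) (g := fun _ => 0)
    (h := fun _ p => cond p.1 (2 * p.2 + 1) (2 * p.2)) Primrec.id (Primrec.const 0) ?_).to_comp
  have h2 : Primrec fun q : Str × Bool × ℕ => q.2.2 := Primrec.snd.comp Primrec.snd
  exact Primrec.cond (Primrec.fst.comp Primrec.snd) (Primrec.nat_double_succ.comp h2)
    (Primrec.nat_double.comp h2)

/-- Allows several numerical parameters to be packed into one while the cost stays logarithmic. -/
theorem Nat.size_pair_le (a b : ℕ) : (Nat.pair a b).size ≤ 2 * (a.size + b.size) := by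
  rw [Nat.size_le]
  have ha : a < 2 ^ (a.size + b.size) := a.lt_size_self.trans_le
    (Nat.pow_le_pow_right two_pos (Nat.le_add_right _ _))
  have hb : b < 2 ^ (a.size + b.size) := b.lt_size_self.trans_le
    (Nat.pow_le_pow_right two_pos (Nat.le_add_left _ _))
  refine (Nat.pair_lt_max_add_one_sq a b).trans_le ?_
  rw [mul_comm 2, pow_mul]
  exact Nat.pow_le_pow_left (max_lt ha hb) 2

/-- The finite set of the bit strings of length at most `k`. -/
def shortStrings : ℕ → Finset Str
  | 0 => {[]}
  | k + 1 => insert [] ((Finset.univ ×ˢ shortStrings k).image fun p : Bool × Str => p.1 :: p.2)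

theorem mem_shortStrings {k : ℕ} {p : Str} (h : p.length ≤ k) : p ∈ shortStrings k := by
  induction k generalizing p with
  | zero => simpa [shortStrings] using h
  | succ k ih =>
    cases p with
    | nil => simp [shortStrings]
    | cons b p =>
      simp only [shortStrings, Finset.mem_insert, Finset.mem_image]
      exact Or.inr ⟨(b, p), by simpa using ih (by simpa using h), rfl⟩

theorem card_shortStrings_lt (k : ℕ) : (shortStrings k).card < 2 ^ (k + 1) := by
  induction k with
  | zero => simp [shortStrings]
  | succ k ih =>
    have h1 := Finset.card_insert_le ([] : Str)
      ((Finset.univ ×ˢ shortStrings k).image fun p : Bool × Str => p.1 :: p.2)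
    have h2 := Finset.card_image_le (s := Finset.univ ×ˢ shortStrings k)
      (f := fun p : Bool × Str => p.1 :: p.2)
    rw [Finset.card_product, Finset.card_univ, Fintype.card_bool] at h2
    rw [shortStrings, pow_succ]
    omega

theorem KC_le_length_of_mem {U : Machine} {p : Str} {xs ys : List Str} (h : xs ∈ U (p, ys)) :
    KC U xs ys ≤ p.length :=
  Nat.sInf_le ⟨p, rfl, h⟩

/-! ### Descriptions by enumeration and the chain rule -/

namespace IsOptimal

variable {U : Machine}

theorem exists_KC_le (hU : IsOptimal U) {V : Machine} (hV : Partrec V) :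
    ∃ c : ℕ, ∀ p xs ys, xs ∈ V (p, ys) → KC U xs ys ≤ p.length + c := by
  obtain ⟨c, hc⟩ := hU.2 V hV
  refine ⟨c, fun p xs ys h => ?_⟩
  obtain ⟨p', hp', hx⟩ := hc p xs ys h
  exact (KC_le_length_of_mem hx).trans hp'

/-- The machine that decodes the length of its program produces every tuple under every condition,
so by optimality the set in `KC` is nonempty and its infimum is attained. -/
theorem exists_program (hU : IsOptimal U) (xs ys : List Str) :
    ∃ p : Str, p.length = KC U xs ys ∧ xs ∈ U (p, ys) := by
  let V : Machine := fun a => ((Encodable.decode a.1.length : Option (List Str)) : Part (List Str))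
  have hV : Partrec V := Computable.ofOption
    (Computable.decode.comp (Computable.list_length.comp Computable.fst))
  obtain ⟨c, hc⟩ := hU.2 V hV
  obtain ⟨p, -, hp⟩ := hc (List.replicate (Encodable.encode xs) true) xs ys (by simp [V])
  have := Nat.sInf_mem (s := {k : ℕ | ∃ p : Str, p.length = k ∧ xs ∈ U (p, ys)}) ⟨_, p, rfl, hp⟩
  exact this

/-- A method that uses a number `m` besides the program `p` costs `|p| + 2 log m` bits. -/
theorem exists_KC_le_of_param (hU : IsOptimal U) {F : (ℕ × Str) × List Str →. List Str}
    (hF : Partrec F) :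
    ∃ c : ℕ, ∀ m p xs ys, xs ∈ F ((m, p), ys) → KC U xs ys ≤ p.length + 2 * m.size + c := by
  let len : Str → ℕ := fun p => (p.takeWhile id).length
  let rest : Str → Str := fun p => (p.dropWhile id).tail
  have hlen : Computable len :=
    Computable.list_length.comp (Primrec.list_takeWhile Primrec.id).to_comp
  have hrest : Computable rest :=
    Primrec.list_tail.to_comp.comp (Primrec.list_dropWhile Primrec.id).to_comp
  let V : Machine := fun a =>
    F ((bitsVal ((rest a.1).take (len a.1)), (rest a.1).drop (len a.1)), a.2)
  have hV : Partrec V := by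
    refine hF.comp (Computable.pair (Computable.pair ?_ ?_) Computable.snd)
    · exact computable_bitsVal.comp (Primrec.list_take.to_comp.comp
        (hlen.comp Computable.fst) (hrest.comp Computable.fst))
    · exact Primrec.list_drop.to_comp.comp (hlen.comp Computable.fst)
        (hrest.comp Computable.fst)
  obtain ⟨c, hc⟩ := hU.exists_KC_le hV
  refine ⟨c + 1, fun m p xs ys h => ?_⟩
  -- The unary block announces how many of the following bits encode `m`, so the program needs no
  -- other separator. The zero accounts for the `+ 1` in the constant.
  set q : Str := List.replicate m.size true ++ false :: (m.bits ++ p) with hq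
  have h1 : len q = m.size := by
    simp only [len, hq]
    rw [List.takeWhile_append_of_pos (by simp)]
    simp
  have h2 : rest q = m.bits ++ p := by
    simp only [rest, hq]
    rw [List.dropWhile_append_of_pos (by simp)]
    simp
  have h3 : m.bits.length = m.size := Nat.size_eq_bits_len m
  have := hc q xs ys (by
    simp only [V, h1, h2]
    rwa [← h3, List.take_left, List.drop_left, bitsVal_bits])
  refine this.trans (le_of_eq ?_)
  simp only [hq, List.length_append, List.length_replicate, List.length_cons, h3]
  ring

/-- Preprocess the condition by `g` and the output by `f`. Permuting tuples, projecting them and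
discarding conditions are all instances. -/
theorem exists_KC_map_le (hU : IsOptimal U) {f g : List Str → List Str} (hf : Computable f)
    (hg : Computable g) : ∃ c : ℕ, ∀ xs ys, KC U (f xs) ys ≤ KC U xs (g ys) + c := by
  let V : Machine := fun a => (U (a.1, g a.2)).map f
  have hV : Partrec V := Partrec.map
    (hU.1.comp (Computable.pair Computable.fst (hg.comp Computable.snd)))
    (hf.comp Computable.snd)
  obtain ⟨c, hc⟩ := hU.exists_KC_le hV
  refine ⟨c, fun xs ys => ?_⟩
  obtain ⟨p, hp, hx⟩ := hU.exists_program xs (g ys)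
  rw [← hp]
  exact hc p _ ys (Part.mem_map f hx)

theorem exists_KC_singleton_le (hU : IsOptimal U) :
    ∃ c : ℕ, ∀ x ys, KC U [x] ys ≤ x.length + c := by
  obtain ⟨c, hc⟩ := hU.exists_KC_le (V := fun a => Part.some [a.1])
    (Computable.list_cons.comp Computable.fst (Computable.const []))
  exact ⟨c, fun x ys => hc x [x] ys (Part.mem_some _)⟩

theorem exists_KC_nil_le (hU : IsOptimal U) : ∃ c : ℕ, ∀ ys, KC U [] ys ≤ c := by
  obtain ⟨c, hc⟩ := hU.exists_KC_le (V := fun _ => Part.some []) (Computable.const [])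
  exact ⟨c, fun ys => by simpa using hc [] [] ys (Part.mem_some _)⟩

/-- The easy direction of the chain rule. -/
theorem exists_KC_append_le (hU : IsOptimal U) : ∃ c : ℕ, ∀ xs zs ys,
    KC U (xs ++ zs) ys ≤ KC U xs ys + KC U zs (xs ++ ys) + 2 * (KC U xs ys).size + c := by
  let F : (ℕ × Str) × List Str →. List Str := fun a =>
    (U (a.1.2.take a.1.1, a.2)).bind fun xs =>
      (U (a.1.2.drop a.1.1, xs ++ a.2)).map fun zs => xs ++ zs
  have hn : Computable fun a : (ℕ × Str) × List Str => a.1.1 :=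
    Computable.fst.comp Computable.fst
  have hp : Computable fun a : (ℕ × Str) × List Str => a.1.2 :=
    Computable.snd.comp Computable.fst
  have hF : Partrec F := by
    refine Partrec.bind (hU.1.comp (Computable.pair
      (Primrec.list_take.to_comp.comp hn hp) Computable.snd)) ?_
    refine Partrec.map (hU.1.comp (Computable.pair
      (Primrec.list_drop.to_comp.comp (hn.comp Computable.fst) (hp.comp Computable.fst))
      (Computable.list_append.comp Computable.snd (Computable.snd.comp Computable.fst)))) ?_
    exact Computable.list_append.comp (Computable.snd.comp Computable.fst) Computable.snd
  obtain ⟨c, hc⟩ := hU.exists_KC_le_of_param hF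
  refine ⟨c, fun xs zs ys => ?_⟩
  obtain ⟨p, hp, hx⟩ := hU.exists_program xs ys
  obtain ⟨p', hp', hz⟩ := hU.exists_program zs (xs ++ ys)
  -- The numerical parameter tells where the first program ends in the concatenation.
  have := hc p.length (p ++ p') (xs ++ zs) ys (by
    simp only [F, List.take_left, List.drop_left]
    exact Part.mem_bind hx (Part.mem_map _ hz))
  rwa [List.length_append, hp, hp'] at this

/-- An element of a finite semidecidable set is described by its number in an enumeration. -/
theorem exists_KC_le_of_semiDec (hU : IsOptimal U) {P : (ℕ × List Str) × List Str → Prop}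
    (hP : SemiDec P) : ∃ c : ℕ, ∀ m ys xs (s : Finset (List Str)), P ((m, ys), xs) →
      (∀ xs', P ((m, ys), xs') → xs' ∈ s) → KC U xs ys ≤ s.card.size + 2 * m.size + c := by
  obtain ⟨F, hF, hFP⟩ := hP.exists_partrec_index
  have hG : Partrec fun a : (ℕ × Str) × List Str => F ((a.1.1, a.2), bitsVal a.1.2) :=
    hF.comp (Computable.pair
      (Computable.pair (Computable.fst.comp Computable.fst) Computable.snd)
      (computable_bitsVal.comp (Computable.snd.comp Computable.fst)))
  obtain ⟨c, hc⟩ := hU.exists_KC_le_of_param hG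
  refine ⟨c, fun m ys xs s hxs hs => ?_⟩
  obtain ⟨i, hi, hx⟩ := hFP (m, ys) xs s hxs hs
  have := hc m i.bits xs ys (by simpa only [bitsVal_bits] using hx)
  rw [Nat.size_eq_bits_len] at this
  have := Nat.size_le_size hi.le
  omega

/-- The finite set of the tuples of complexity at most `k` has less than `2 ^ (k + 1)` elements. -/
theorem exists_finset_KC_le (hU : IsOptimal U) (k : ℕ) (ys : List Str) :
    ∃ s : Finset (List Str), s.card < 2 ^ (k + 1) ∧ ∀ xs, xs ∈ s ↔ KC U xs ys ≤ k := by
  classical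
  let g : Str → List Str := fun p => if h : (U (p, ys)).Dom then (U (p, ys)).get h else []
  refine ⟨((shortStrings k).image g).filter fun xs => KC U xs ys ≤ k, ?_, fun xs => ?_⟩
  · exact ((Finset.card_filter_le _ _).trans Finset.card_image_le).trans_lt
      (card_shortStrings_lt k)
  · rw [Finset.mem_filter, Finset.mem_image, and_iff_right_iff_imp]
    intro h
    obtain ⟨p, hp, hx⟩ := hU.exists_program xs ys
    refine ⟨p, mem_shortStrings (hp ▸ h), ?_⟩
    obtain ⟨hd, rfl⟩ := hx
    simp [g, hd]

/-- Complexity is approximable from above: search for a halting program of length at most the bound.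
-/
theorem semiDec_KC_le (hU : IsOptimal U) :
    SemiDec fun a : (ℕ × List Str) × List Str => KC U a.2 a.1.2 ≤ a.1.1 := by
  have h1 : SemiDec fun b : ((ℕ × List Str) × List Str) × Str =>
      decide (b.2.length ≤ b.1.1.1) = true ∧ b.1.2 ∈ U (b.2, b.1.1.2) := by
    refine SemiDec.and (SemiDec.of_bool (Primrec.nat_le.decide.to_comp.comp
      (Computable.list_length.comp Computable.snd)
      (Computable.fst.comp (Computable.fst.comp Computable.fst)))) ?_
    exact (Partrec.semiDec_graph hU.1).comp (g := fun b : ((ℕ × List Str) × List Str) × Str =>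
      ((b.2, b.1.1.2), b.1.2)) (Computable.pair (Computable.pair Computable.snd
        (Computable.snd.comp (Computable.fst.comp Computable.fst)))
        (Computable.snd.comp Computable.fst))
  refine h1.exists.of_iff fun a => ?_
  simp only [decide_eq_true_eq]
  constructor
  · intro h
    obtain ⟨p, hp, hx⟩ := hU.exists_program a.2 a.1.2
    exact ⟨p, hp ▸ h, hx⟩
  · rintro ⟨p, hp, hx⟩
    exact (KC_le_length_of_mem hx).trans hp

/-- The hard direction of the chain rule (symmetry of information). -/
theorem exists_le_KC_append (hU : IsOptimal U) : ∃ c : ℕ, ∀ xs zs ys,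
    KC U xs ys + KC U zs (xs ++ ys) ≤
      KC U (xs ++ zs) ys + 20 * ((KC U (xs ++ zs) ys).size + xs.length.size) + c := by
  classical
  have hpr : Computable (fun m : ℕ => m.unpair.1) := Computable.fst.comp Computable.unpair
  have hpr' : Computable (fun m : ℕ => m.unpair.2) := Computable.snd.comp Computable.unpair
  -- continuations of a fixed tuple
  let P₁ : (ℕ × List Str) × List Str → Prop := fun a =>
    KC U (a.1.2.take a.1.1.unpair.2 ++ a.2) (a.1.2.drop a.1.1.unpair.2) ≤ a.1.1.unpair.1
  have hP₁ : SemiDec P₁ := by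
    have hm : Computable fun a : (ℕ × List Str) × List Str => a.1.1 :=
      Computable.fst.comp Computable.fst
    have hw : Computable fun a : (ℕ × List Str) × List Str => a.1.2 :=
      Computable.snd.comp Computable.fst
    exact hU.semiDec_KC_le.comp (g := fun a : (ℕ × List Str) × List Str =>
      ((a.1.1.unpair.1, a.1.2.drop a.1.1.unpair.2), a.1.2.take a.1.1.unpair.2 ++ a.2))
      (Computable.pair (Computable.pair (hpr.comp hm)
        (Primrec.list_drop.to_comp.comp (hpr'.comp hm) hw))
        (Computable.list_append.comp (Primrec.list_take.to_comp.comp (hpr'.comp hm) hw)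
          Computable.snd))
  -- tuples with many continuations
  let P₂ : (ℕ × List Str) × List Str → Prop := fun a =>
    -- Fixing the number of components makes the splitting of a concatenated tuple unique, which the
    -- counting of `B` needs.
    decide (a.2.length = a.1.1.unpair.1.unpair.2) = true ∧
      ∃ s : Finset (List Str), 2 ^ a.1.1.unpair.2 ≤ s.card ∧
        ∀ zs ∈ s, KC U (a.2 ++ zs) a.1.2 ≤ a.1.1.unpair.1.unpair.1
  have hP₂ : SemiDec P₂ := by
    have hm : Computable fun a : (ℕ × List Str) × List Str => a.1.1 :=
      Computable.fst.comp Computable.fst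
    have hk : Computable fun a : (ℕ × List Str) × List Str => a.1.1.unpair.1.unpair.1 :=
      hpr.comp (hpr.comp hm)
    refine SemiDec.and (SemiDec.of_bool (Primrec.eq.decide.to_comp.comp
      (Computable.list_length.comp Computable.snd) (hpr'.comp (hpr.comp hm)))) ?_
    have hQ : SemiDec fun b : ((ℕ × List Str) × List Str) × List Str =>
        KC U (b.1.2 ++ b.2) b.1.1.2 ≤ b.1.1.1.unpair.1.unpair.1 :=
      hU.semiDec_KC_le.comp (g := fun b : ((ℕ × List Str) × List Str) × List Str =>
        ((b.1.1.1.unpair.1.unpair.1, b.1.1.2), b.1.2 ++ b.2))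
        (Computable.pair (Computable.pair (hk.comp Computable.fst)
          (Computable.snd.comp (Computable.fst.comp Computable.fst)))
          (Computable.list_append.comp (Computable.snd.comp Computable.fst) Computable.snd))
    have hpow : Computable fun m : ℕ => 2 ^ m := by
      refine (Primrec.nat_rec₁ (f := fun _ r => 2 * r) 1
        (Primrec.nat_double.comp Primrec.snd)).to_comp.of_eq fun m => ?_
      induction m with
      | zero => rfl
      | succ m ih => rw [pow_succ, ← ih, mul_comm]
    exact hQ.card_ge.comp (g := fun a : (ℕ × List Str) × List Str => (a, 2 ^ a.1.1.unpair.2))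
      (Computable.pair Computable.id (hpow.comp (hpr'.comp hm)))
  obtain ⟨c₁, hc₁⟩ := hU.exists_KC_le_of_semiDec hP₁
  obtain ⟨c₂, hc₂⟩ := hU.exists_KC_le_of_semiDec hP₂
  refine ⟨c₁ + c₂ + 30, fun xs zs ys => ?_⟩
  set k := KC U (xs ++ zs) ys with hk
  obtain ⟨O, hO, hOmem⟩ := hU.exists_finset_KC_le k ys
  let A : List Str → Finset (List Str) := fun xs' =>
    (O.filter fun o => o.take xs.length = xs').image fun o => o.drop xs.length
  have hA : ∀ xs' zs' : List Str, xs'.length = xs.length → KC U (xs' ++ zs') ys ≤ k →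
      zs' ∈ A xs' := by
    intro xs' zs' hlen h
    refine Finset.mem_image.2 ⟨xs' ++ zs', Finset.mem_filter.2 ⟨(hOmem _).2 h, ?_⟩, ?_⟩
    · rw [← hlen, List.take_left]
    · rw [← hlen, List.drop_left]
  have hA' : ∀ zs', zs' ∈ A xs → KC U (xs ++ zs') ys ≤ k := by
    intro zs' h
    obtain ⟨o, ho, rfl⟩ := Finset.mem_image.1 h
    obtain ⟨ho, ht⟩ := Finset.mem_filter.1 ho
    have hxo : xs ++ o.drop xs.length = o := by
      conv_rhs => rw [← List.take_append_drop xs.length o, ht]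
    rw [hxo]
    exact (hOmem _).1 ho
  have hpos : (A xs).card ≠ 0 := Finset.card_ne_zero_of_mem (hA xs zs rfl hk.symm.le)
  -- About `m` bits select `zs` among the continuations of `xs`. At most about 2^(k-m) tuples have
  -- 2^m continuations, so about `k - m` bits select `xs`. With the threshold a power of two, only
  -- its exponent has to be communicated.
  set m := Nat.log 2 (A xs).card with hm
  have hm₁ : 2 ^ m ≤ (A xs).card := Nat.pow_log_le_self 2 hpos
  have hm₂ : (A xs).card.size ≤ m + 1 := Nat.size_le.2 (Nat.lt_pow_succ_log_self one_lt_two _)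
  have hmk : m ≤ k := by
    have h1 : (A xs).card ≤ O.card := Finset.card_image_le.trans (Finset.card_filter_le _ _)
    have h2 : 2 ^ m < 2 ^ (k + 1) := hm₁.trans_lt (h1.trans_lt hO)
    exact Nat.lt_succ_iff.1 ((Nat.pow_lt_pow_iff_right one_lt_two).1 h2)
  have e₁ : KC U zs (xs ++ ys) ≤ (A xs).card.size + 2 * (Nat.pair k xs.length).size + c₁ := by
    refine hc₁ _ _ _ (A xs) ?_ fun zs' h => ?_
    · simp [P₁, hk]
    · exact hA xs zs' rfl (by simpa [P₁] using h)
  let B : Finset (List Str) := (O.image fun o => o.take xs.length).filter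
    fun xs' => 2 ^ m ≤ (A xs').card
  have hB : B.card * 2 ^ m ≤ O.card := by
    rw [← smul_eq_mul]
    -- Continuations of different prefixes come from disjoint fibres of `O`.
    refine (Finset.card_nsmul_le_sum B (fun xs' => (A xs').card) _
      fun b hb => (Finset.mem_filter.1 hb).2).trans ?_
    refine (Finset.sum_le_sum fun b _ => Finset.card_image_le).trans ?_
    rw [Finset.sum_card_fiberwise_eq_card_filter]
    exact Finset.card_filter_le _ _
  have hBsize : B.card.size ≤ k + 1 - m := by
    rw [Nat.size_le]
    refine Nat.lt_of_mul_lt_mul_right (a := 2 ^ m) (hB.trans_lt (hO.trans_le ?_))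
    rw [← pow_add]
    exact Nat.pow_le_pow_right two_pos (by omega)
  have e₂ : KC U xs ys ≤
      B.card.size + 2 * (Nat.pair (Nat.pair k xs.length) m).size + c₂ := by
    refine hc₂ _ _ _ B ?_ fun xs' h => ?_
    · simp only [P₂, Nat.unpair_pair, decide_eq_true_eq]
      exact ⟨trivial, A xs, hm₁, hA'⟩
    · simp only [P₂, Nat.unpair_pair, decide_eq_true_eq] at h
      obtain ⟨hlen, s, hs, hsk⟩ := h
      have hsA : s ⊆ A xs' := fun z hz => hA xs' z hlen (hsk z hz)
      obtain ⟨z, hz⟩ := Finset.card_pos.1 ((Nat.two_pow_pos m).trans_le hs)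
      refine Finset.mem_filter.2 ⟨Finset.mem_image.2 ⟨xs' ++ z, (hOmem _).2 (hsk z hz), ?_⟩,
        hs.trans (Finset.card_le_card hsA)⟩
      rw [← hlen, List.take_left]
  have s₁ := Nat.size_pair_le k xs.length
  have s₂ := Nat.size_pair_le (Nat.pair k xs.length) m
  have s₃ := Nat.size_le_size hmk
  omega

end IsOptimal

/-! ### Logarithmic error terms -/

/-- The logarithmic term `log₂ (N + 2)`. -/
noncomputable def lg (N : ℕ) : ℝ := Real.logb 2 ((N : ℝ) + 2)

theorem lg_mono {M N : ℕ} (h : M ≤ N) : lg M ≤ lg N := by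
  have : (M : ℝ) ≤ N := by exact_mod_cast h
  exact Real.logb_le_logb_of_le one_lt_two (by positivity) (by linarith)

theorem one_le_lg (N : ℕ) : 1 ≤ lg N := by
  refine le_trans (by simp [lg]) (lg_mono N.zero_le)

theorem size_le_logb_add_one {m : ℕ} (hm : m ≠ 0) : (m.size : ℝ) ≤ Real.logb 2 m + 1 := by
  have h1 : 0 < m.size := Nat.size_pos.2 (Nat.pos_of_ne_zero hm)
  have h2 : 2 ^ (m.size - 1) ≤ m := Nat.lt_size.1 (Nat.sub_lt h1 one_pos)
  have h3 : (2 : ℝ) ^ (m.size - 1) ≤ m := by exact_mod_cast h2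
  have h4 : ((m.size - 1 : ℕ) : ℝ) ≤ Real.logb 2 m := by
    rw [Real.le_logb_iff_rpow_le one_lt_two (by positivity), Real.rpow_natCast]
    exact h3
  rw [Nat.cast_sub h1] at h4
  push_cast at h4
  linarith

theorem size_le_lg (m : ℕ) : (m.size : ℝ) ≤ 2 * lg m := by
  rcases eq_or_ne m 0 with rfl | hm
  · have := one_le_lg 0
    simp only [Nat.size_zero, Nat.cast_zero]
    linarith
  · have h1 := size_le_logb_add_one hm
    have h2 : Real.logb 2 m ≤ lg m := Real.logb_le_logb_of_le one_lt_two (by positivity) (by simp)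
    have h3 := one_le_lg m
    linarith

/-- Complexities and graph indices are at most linear in the lengths involved, so writing them down
costs only a logarithmic term. -/
theorem exists_size_le_lg (a : ℕ) :
    ∃ c : ℝ, 0 ≤ c ∧ ∀ m N : ℕ, m ≤ a * (N + 1) → (m.size : ℝ) ≤ c * lg N := by
  have ha : 0 ≤ lg a := zero_le_one.trans (one_le_lg a)
  refine ⟨2 * (lg a + 1), by positivity, fun m N h => ?_⟩
  have h0 : (m : ℝ) ≤ a * (N + 1) := by exact_mod_cast h
  have h1 : lg m ≤ lg a + lg N := by
    rw [lg, lg, lg, ← Real.logb_mul (by positivity) (by positivity)]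
    refine Real.logb_le_logb_of_le one_lt_two (by positivity) ?_
    have : (0 : ℝ) ≤ a := by positivity
    have : (0 : ℝ) ≤ N := by positivity
    nlinarith
  have h2 := size_le_lg m
  have h3 := one_le_lg N
  nlinarith

theorem logTerm_eq_lg (ss : List Str) : logTerm ss = lg (totalLength ss) := rfl

@[simp]
theorem totalLength_nil : totalLength [] = 0 := rfl

@[simp]
theorem totalLength_cons (x : Str) (xs : List Str) :
    totalLength (x :: xs) = x.length + totalLength xs := by
  simp [totalLength]

@[simp]
theorem totalLength_append (xs ys : List Str) :
    totalLength (xs ++ ys) = totalLength xs + totalLength ys := by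
  simp [totalLength]

/-- The components of a tuple at given positions. -/
def pick (is : List ℕ) (l : List Str) : List Str := is.map fun i => l.getD i []

theorem computable_pick (is : List ℕ) : Computable (pick is) := by
  induction is with
  | nil => exact Computable.const []
  | cons i is ih =>
    exact Computable.list_cons.comp
      ((Primrec.list_getD ([] : Str)).to_comp.comp Computable.id (Computable.const i)) ih

theorem semiDec_list_mem {β : Type*} [Primcodable β] [DecidableEq β] :
    SemiDec fun p : List β × β => p.2 ∈ p.1 :=
  (SemiDec.of_bool (computable_decide_list_mem (β := β))).of_iff fun p => by
    simp only [decide_eq_true_eq]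

/-! ### Chain rules with logarithmic error, and descriptions of edges -/

namespace IsOptimal

variable {U : Machine}

theorem exists_KC_le_length (hU : IsOptimal U) (s : ℕ) : ∃ a : ℕ, ∀ xs ys, xs.length = s →
    KC U xs ys ≤ a * (totalLength xs + 1) := by
  induction s with
  | zero =>
    obtain ⟨c, hc⟩ := hU.exists_KC_nil_le
    refine ⟨c, fun xs ys h => ?_⟩
    obtain rfl := List.length_eq_zero_iff.1 h
    simpa using hc ys
  | succ s ih =>
    obtain ⟨a, ha⟩ := ih
    obtain ⟨c, hc⟩ := hU.exists_KC_singleton_le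
    obtain ⟨d, hd⟩ := hU.exists_KC_append_le
    refine ⟨a + 3 * c + d + 3, fun xs ys h => ?_⟩
    obtain ⟨x, xs, rfl⟩ := List.exists_cons_of_length_eq_add_one h
    have h1 := hd [x] xs ys
    have h2 := hc x ys
    have h3 := ha xs ([x] ++ ys) (by simpa using h)
    have h4 : (KC U [x] ys).size ≤ KC U [x] ys := Nat.size_le.2 Nat.lt_two_pow_self
    rw [List.singleton_append] at h1
    rw [totalLength_cons]
    nlinarith [Nat.zero_le (a * x.length), Nat.zero_le (c * x.length),
      Nat.zero_le (c * totalLength xs), Nat.zero_le (d * x.length),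
      Nat.zero_le (d * totalLength xs)]

/-- The easy direction of the chain rule, with the condition in front. -/
theorem exists_chain_le (hU : IsOptimal U) (s u : ℕ) : ∃ c : ℝ, 0 ≤ c ∧ ∀ xs zs ws (N : ℕ),
    xs.length = s → ws.length = u → totalLength xs ≤ N →
    (KC U (xs ++ zs) ws : ℝ) ≤ KC U xs ws + KC U zs (ws ++ xs) + c * lg N := by
  obtain ⟨a, ha⟩ := hU.exists_KC_le_length s
  obtain ⟨c₁, hc₁, h₁⟩ := exists_size_le_lg a
  obtain ⟨c₂, h₂⟩ := hU.exists_KC_append_le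
  obtain ⟨c₃, h₃⟩ := hU.exists_KC_map_le (f := id) (g := fun l => l.drop s ++ l.take s)
    Computable.id (Computable.list_append.comp
      (Primrec.list_drop.to_comp.comp (Computable.const s) Computable.id)
      (Primrec.list_take.to_comp.comp (Computable.const s) Computable.id))
  refine ⟨2 * c₁ + c₂ + c₃, by positivity, fun xs zs ws N hx hw hN => ?_⟩
  have e₁ := h₁ (KC U xs ws) N ((ha xs ws hx).trans (by gcongr))
  have e₂ := h₂ xs zs ws
  have e₃ := h₃ zs (xs ++ ws)
  simp only [id, ← hx, List.drop_left, List.take_left] at e₃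
  have e₄ : (KC U (xs ++ zs) ws : ℝ) ≤
      KC U xs ws + (KC U zs (ws ++ xs) + c₃) + 2 * (KC U xs ws).size + c₂ := by
    exact_mod_cast e₂.trans (by gcongr)
  have hl := one_le_lg N
  have hc₂ : (c₂ : ℝ) ≤ c₂ * lg N := le_mul_of_one_le_right (by positivity) hl
  have hc₃ : (c₃ : ℝ) ≤ c₃ * lg N := le_mul_of_one_le_right (by positivity) hl
  linarith

/-- The hard direction of the chain rule, with the condition in front. -/
theorem exists_le_chain (hU : IsOptimal U) (s r u : ℕ) : ∃ c : ℝ, 0 ≤ c ∧ ∀ xs zs ws (N : ℕ),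
    xs.length = s → zs.length = r → ws.length = u → totalLength xs + totalLength zs ≤ N →
    (KC U xs ws + KC U zs (ws ++ xs) : ℝ) ≤ KC U (xs ++ zs) ws + c * lg N := by
  obtain ⟨a, ha⟩ := hU.exists_KC_le_length (s + r)
  obtain ⟨c₁, hc₁, h₁⟩ := exists_size_le_lg a
  obtain ⟨c₂, h₂⟩ := hU.exists_le_KC_append
  obtain ⟨c₃, h₃⟩ := hU.exists_KC_map_le (f := id) (g := fun l => l.drop u ++ l.take u)
    Computable.id (Computable.list_append.comp
      (Primrec.list_drop.to_comp.comp (Computable.const u) Computable.id)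
      (Primrec.list_take.to_comp.comp (Computable.const u) Computable.id))
  refine ⟨20 * c₁ + 20 * s.size + c₂ + c₃, by positivity, fun xs zs ws N hx hz hw hN => ?_⟩
  have e₁ := h₁ (KC U (xs ++ zs) ws) N ((ha (xs ++ zs) ws (by simp [hx, hz])).trans
    (by rw [totalLength_append]; gcongr))
  have e₂ := h₂ xs zs ws
  have e₃ := h₃ zs (ws ++ xs)
  simp only [id, ← hw, List.drop_left, List.take_left] at e₃
  rw [hx] at e₂
  have e₂' : (KC U xs ws + KC U zs (xs ++ ws) : ℝ) ≤
      KC U (xs ++ zs) ws + 20 * ((KC U (xs ++ zs) ws).size + s.size) + c₂ := by exact_mod_cast e₂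
  have e₃' : (KC U zs (ws ++ xs) : ℝ) ≤ KC U zs (xs ++ ws) + c₃ := by exact_mod_cast e₃
  have hl := one_le_lg N
  have hs : (s.size : ℝ) ≤ s.size * lg N := le_mul_of_one_le_right (by positivity) hl
  have hc₂ : (c₂ : ℝ) ≤ c₂ * lg N := le_mul_of_one_le_right (by positivity) hl
  have hc₃ : (c₃ : ℝ) ≤ c₃ * lg N := le_mul_of_one_le_right (by positivity) hl
  linarith

/-- Rearranging the described tuple and the condition costs a constant. -/
theorem exists_rearrange_le (hU : IsOptimal U) {f g : List Str → List Str} (hf : Computable f)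
    (hg : Computable g) :
    ∃ c : ℝ, 0 ≤ c ∧ ∀ xs ys N, (KC U (f xs) ys : ℝ) ≤ KC U xs (g ys) + c * lg N := by
  obtain ⟨c, hc⟩ := hU.exists_KC_map_le hf hg
  refine ⟨c, by positivity, fun xs ys N => ?_⟩
  have h1 : (KC U (f xs) ys : ℝ) ≤ KC U xs (g ys) + c := by exact_mod_cast hc xs ys
  have h2 : (c : ℝ) ≤ c * lg N := le_mul_of_one_le_right (by positivity) (one_le_lg N)
  linarith

/-- An edge of an explicitly given graph is described by its number among the edges whose
endpoints are at most as complex. -/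
theorem exists_KC_edge_le (hU : IsOptimal U) {G : ℕ → BipGraph} (hG : BipGraph.IsExplicit G) :
    ∃ c : ℕ, ∀ k x y w (F : Finset (Str × Str)), (x, y) ∈ (G k).E →
      (∀ x' y', (x', y') ∈ (G k).E → KC U [x'] [w] ≤ KC U [x] [w] →
        KC U [y'] [w] ≤ KC U [y] [w] → (x', y') ∈ F) →
      KC U [x, y] [w] ≤
        F.card.size + 20 * (k.size + (KC U [x] [w]).size + (KC U [y] [w]).size) + c := by
  obtain ⟨_, _, e, _, _, he, hGe⟩ := hG
  have hpr : Computable (fun m : ℕ => m.unpair.1) := Computable.fst.comp Computable.unpair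
  have hpr' : Computable (fun m : ℕ => m.unpair.2) := Computable.snd.comp Computable.unpair
  let P : (ℕ × List Str) × List Str → Prop := fun a =>
    (decide (a.2.length = 2) = true ∧
      (a.2.getD 0 [], a.2.getD 1 []) ∈ e a.1.1.unpair.1) ∧
    KC U [a.2.getD 0 []] a.1.2 ≤ a.1.1.unpair.2.unpair.1 ∧
    KC U [a.2.getD 1 []] a.1.2 ≤ a.1.1.unpair.2.unpair.2
  have hP : SemiDec P := by
    have hm : Computable fun a : (ℕ × List Str) × List Str => a.1.1 :=
      Computable.fst.comp Computable.fst
    have hw : Computable fun a : (ℕ × List Str) × List Str => a.1.2 :=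
      Computable.snd.comp Computable.fst
    have hget : ∀ i, Computable fun a : (ℕ × List Str) × List Str => a.2.getD i [] := fun i =>
      (Primrec.list_getD ([] : Str)).to_comp.comp Computable.snd (Computable.const i)
    have hsingle : ∀ i, Computable fun a : (ℕ × List Str) × List Str => [a.2.getD i []] := fun i =>
      Computable.list_cons.comp (hget i) (Computable.const [])
    refine SemiDec.and (SemiDec.and (SemiDec.of_bool ?_) ?_)
      (SemiDec.and ?_ ?_)
    · exact Primrec.eq.decide.to_comp.comp (Computable.list_length.comp Computable.snd)
        (Computable.const 2)
    · exact semiDec_list_mem.comp (g := fun a : (ℕ × List Str) × List Str =>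
        (e a.1.1.unpair.1, (a.2.getD 0 [], a.2.getD 1 [])))
        (Computable.pair (he.comp (hpr.comp hm)) (Computable.pair (hget 0) (hget 1)))
    · exact hU.semiDec_KC_le.comp (g := fun a : (ℕ × List Str) × List Str =>
        ((a.1.1.unpair.2.unpair.1, a.1.2), [a.2.getD 0 []]))
        (Computable.pair (Computable.pair (hpr.comp (hpr'.comp hm)) hw) (hsingle 0))
    · exact hU.semiDec_KC_le.comp (g := fun a : (ℕ × List Str) × List Str =>
        ((a.1.1.unpair.2.unpair.2, a.1.2), [a.2.getD 1 []]))
        (Computable.pair (Computable.pair (hpr'.comp (hpr'.comp hm)) hw) (hsingle 1))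
  obtain ⟨c, hc⟩ := hU.exists_KC_le_of_semiDec hP
  refine ⟨c, fun k x y w F hxy hF => ?_⟩
  have hE : ∀ z, z ∈ (G k).E ↔ z ∈ e k := fun z => by rw [(hGe k).2.2, List.mem_toFinset]
  -- Only the graph index and the two complexity thresholds are supplied; they determine the
  -- enumeration given `w`.
  have h := hc (Nat.pair k (Nat.pair (KC U [x] [w]) (KC U [y] [w]))) [w] [x, y]
    (F.image fun z => [z.1, z.2]) ?_ ?_
  · have h1 : (F.image fun z => [z.1, z.2]).card.size ≤ F.card.size :=
      Nat.size_le_size Finset.card_image_le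
    have h2 := Nat.size_pair_le k (Nat.pair (KC U [x] [w]) (KC U [y] [w]))
    have h3 := Nat.size_pair_le (KC U [x] [w]) (KC U [y] [w])
    omega
  · simpa [P, ← hE] using hxy
  · intro xs h
    simp only [P, Nat.unpair_pair, decide_eq_true_eq, ← hE] at h
    obtain ⟨⟨hlen, hmem⟩, hx, hy⟩ := h
    obtain ⟨x', y', rfl⟩ := List.length_eq_two.1 hlen
    exact Finset.mem_image.2 ⟨(x', y'), hF x' y' hmem hx hy, rfl⟩

end IsOptimal

/-! ### Edges between two sets of vertices -/

/-- Double counting of the pairs of edges of `F` with the same left end. By Cauchy–Schwarz there are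
at least |F|²/|S| of them. Pairs with different right ends are determined by these ends, so there
are at most |T|²; the other pairs are the |F| diagonal ones. -/
theorem BipGraph.BoundedCommonNbhd.card_sq_le {H : BipGraph} (hH : H.BoundedCommonNbhd 1)
    {F : Finset (Str × Str)} {S T : Finset Str} (hE : F ⊆ H.E) (hF : F ⊆ S ×ˢ T) :
    F.card ^ 2 ≤ S.card * (T.card ^ 2 + F.card) := by
  classical
  set d : Str → ℕ := fun x => (F.filter fun z => z.1 = x).card
  have hsum : F.card = ∑ x ∈ S, d x :=
    Finset.card_eq_sum_card_fiberwise fun z hz => (Finset.mem_product.1 (hF hz)).1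
  set P : Finset ((Str × Str) × (Str × Str)) := (F ×ˢ F).filter fun p => p.1.1 = p.2.1
  have hP : P.card = ∑ x ∈ S, d x ^ 2 := by
    rw [Finset.card_eq_sum_card_fiberwise (f := fun p => p.1.1) (t := S)]
    · refine Finset.sum_congr rfl fun x _ => ?_
      rw [sq, ← Finset.card_product]
      congr 1
      ext ⟨z, z'⟩
      simp only [P, Finset.mem_filter, Finset.mem_product]
      constructor
      · rintro ⟨⟨⟨h1, h2⟩, h3⟩, h4⟩
        exact ⟨⟨h1, h4⟩, h2, h3 ▸ h4⟩
      · rintro ⟨⟨h1, h2⟩, h3, h4⟩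
        exact ⟨⟨⟨h1, h3⟩, h2.trans h4.symm⟩, h2⟩
    · intro p hp
      exact (Finset.mem_product.1 (hF (Finset.mem_product.1 (Finset.mem_filter.1 hp).1).1)).1
  have hPle : P.card ≤ T.card ^ 2 + F.card := by
    rw [← Finset.card_filter_add_card_filter_not (s := P) (fun p => p.1.2 ≠ p.2.2)]
    refine add_le_add ?_ ?_
    · rw [sq, ← Finset.card_product]
      refine Finset.card_le_card_of_injOn (fun p => (p.1.2, p.2.2)) ?_ ?_
      · intro p hp
        have := Finset.mem_product.1 (Finset.mem_filter.1 (Finset.mem_filter.1 hp).1).1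
        exact Finset.mem_product.2 ⟨(Finset.mem_product.1 (hF this.1)).2,
          (Finset.mem_product.1 (hF this.2)).2⟩
      · rintro ⟨⟨x, y⟩, x₁, y'⟩ hp ⟨⟨x', y₂⟩, x₂, y₃⟩ hp' h
        simp only [P, Finset.coe_filter, Set.mem_ofPred_eq, Finset.mem_filter, Finset.mem_product,
          Prod.mk.injEq] at hp hp' h
        obtain ⟨⟨⟨h1, h2⟩, rfl⟩, hne⟩ := hp
        obtain ⟨⟨⟨h3, h4⟩, rfl⟩, -⟩ := hp'
        obtain ⟨rfl, rfl⟩ := h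
        have hmem : ∀ {a b}, (a, b) ∈ F → a ∈ H.L ∧ b ∈ H.R ∧ (a, b) ∈ H.E := fun h =>
          ⟨(Finset.mem_product.1 (H.edges_subset (hE h))).1,
            (Finset.mem_product.1 (H.edges_subset (hE h))).2, hE h⟩
        have hcard := hH y (hmem h1).2.1 y' (hmem h2).2.1 hne
        have : x = x' := Finset.card_le_one.1 hcard x
          (by simp [BipGraph.nbrOfRight, hmem h1, hmem h2]) x'
          (by simp [BipGraph.nbrOfRight, hmem h3, hmem h4])
        rw [this]
    · refine Finset.card_le_card_of_injOn (fun p => p.1) ?_ ?_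
      · intro p hp
        exact (Finset.mem_product.1 (Finset.mem_filter.1 (Finset.mem_filter.1 hp).1).1).1
      · rintro ⟨⟨x, y⟩, x₁, y'⟩ hp ⟨⟨x', y₂⟩, x₂, y₃⟩ hp' h
        simp only [P, Finset.coe_filter, Set.mem_ofPred_eq, Finset.mem_filter, Finset.mem_product,
          Prod.mk.injEq, not_not] at hp hp' h
        obtain ⟨⟨-, rfl⟩, rfl⟩ := hp
        obtain ⟨⟨-, rfl⟩, rfl⟩ := hp'
        obtain ⟨rfl, rfl⟩ := h
        rfl
  calc F.card ^ 2 = (∑ x ∈ S, d x) ^ 2 := by rw [hsum]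
    _ ≤ S.card * ∑ x ∈ S, d x ^ 2 := sq_sum_le_card_mul_sum_sq
    _ ≤ _ := by rw [← hP]; gcongr

/-- If the second largest eigenvalue is less than the eigenvalue `μ` of an eigenvector `u`, then it
bounds the quadratic form on the orthogonal complement of `u`. -/
theorem LinearMap.IsSymmetric.inner_le_of_inner_eq_zero {E : Type*} [NormedAddCommGroup E]
    [InnerProductSpace ℝ E] [FiniteDimensional ℝ E] {T : E →ₗ[ℝ] E} (hT : T.IsSymmetric) {n : ℕ}
    (hn : Module.finrank ℝ E = n) (h : 1 < n) {u : E} {μ : ℝ} (hu : u ≠ 0) (hTu : T u = μ • u)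
    (hμ : hT.eigenvalues hn ⟨1, h⟩ < μ) {z : E} (hz : inner ℝ z u = 0) :
    inner ℝ (T z) z ≤ hT.eigenvalues hn ⟨1, h⟩ * inner ℝ z z := by
  set b := hT.eigenvectorBasis hn
  set ev := hT.eigenvalues hn
  have hev : ∀ i, i ≠ ⟨0, by omega⟩ → ev i ≤ ev ⟨1, h⟩ := fun i hi =>
    hT.eigenvalues_antitone hn (by
      have : i.1 ≠ 0 := fun h0 => hi (Fin.ext h0)
      exact Fin.mk_le_of_le_val (by simpa using Nat.one_le_iff_ne_zero.2 this))
  have hTb : ∀ i v, inner ℝ (b i) (T v) = ev i * inner ℝ (b i) v := fun i v => by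
    rw [← hT, hT.apply_eigenvectorBasis hn i]
    exact real_inner_smul_left _ _ _
  -- Eigenvectors for different eigenvalues are orthogonal. So `u` is a multiple of the first basis
  -- vector, and `z` is orthogonal to that vector as well.
  have hbu : ∀ i, i ≠ ⟨0, by omega⟩ → inner ℝ (b i) u = 0 := fun i hi => by
    have h1 := hTb i u
    rw [hTu, real_inner_smul_right] at h1
    have h2 := (hev i hi).trans_lt hμ
    by_contra hne
    exact h2.ne' (mul_right_cancel₀ hne h1)
  have hb0 : inner ℝ (b ⟨0, by omega⟩) u ≠ 0 := fun h0 => hu <| by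
    rw [← b.sum_repr' u]
    refine Finset.sum_eq_zero fun i _ => ?_
    by_cases hi : i = ⟨0, by omega⟩
    · rw [hi, h0, zero_smul]
    · rw [hbu i hi, zero_smul]
  have hz0 : inner ℝ z (b ⟨0, by omega⟩) = 0 := by
    rw [← b.sum_inner_mul_inner z u, Finset.sum_eq_single ⟨0, by omega⟩
      (fun i _ hi => by rw [hbu i hi, mul_zero]) (by simp)] at hz
    exact (mul_eq_zero.1 hz).resolve_right hb0
  rw [real_inner_comm, ← b.sum_inner_mul_inner z (T z), ← b.sum_inner_mul_inner z z,
    Finset.mul_sum]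
  refine Finset.sum_le_sum fun i _ => ?_
  rw [hTb, real_inner_comm z (b i)]
  by_cases hi : i = ⟨0, by omega⟩
  · rw [hi, hz0]
    simp
  · have := mul_le_mul_of_nonneg_right (hev i hi) (mul_self_nonneg (inner ℝ z (b i)))
    linarith

/-- The expander mixing lemma for a matrix with constant row and column sums, from a bound for the
associated bilinear form. -/
theorem sum_le_of_quadratic_bound {α β : Type*} [Fintype α] [Fintype β] [DecidableEq α]
    [DecidableEq β] {B : α → β → ℝ} {N D l : ℝ} (hN : 0 < N)
    (hα : (Fintype.card α : ℝ) = N) (hβ : (Fintype.card β : ℝ) = N)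
    (hrow : ∀ x, ∑ y, B x y = D) (hcol : ∀ y, ∑ x, B x y = D) (hl : 0 ≤ l)
    (hB : ∀ (f : α → ℝ) (g : β → ℝ), ∑ x, f x = 0 → ∑ y, g y = 0 →
      2 * ∑ x, ∑ y, f x * g y * B x y ≤ l * (∑ x, f x ^ 2 + ∑ y, g y ^ 2))
    (S : Finset α) (T : Finset β) (hS : S.Nonempty) (hT : T.Nonempty) :
    ∑ x ∈ S, ∑ y ∈ T, B x y ≤ D * S.card * T.card / N + l * √(S.card * T.card) := by
  have hs : (0 : ℝ) < S.card := by exact_mod_cast hS.card_pos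
  have ht : (0 : ℝ) < T.card := by exact_mod_cast hT.card_pos
  set s : ℝ := (S.card : ℝ)
  set t : ℝ := (T.card : ℝ)
  -- The indicators of `S` and `T` are centred to have zero sum; constant row and column sums make
  -- the correction to the bilinear form explicit.
  let f : α → ℝ := fun x => (if x ∈ S then 1 else 0) - s / N
  let g : β → ℝ := fun y => (if y ∈ T then 1 else 0) - t / N
  have hf1 : ∑ x, (if x ∈ S then (1 : ℝ) else 0) = s := by simp [s]
  have hg1 : ∑ y, (if y ∈ T then (1 : ℝ) else 0) = t := by simp [t]
  have hf0 : ∑ x, f x = 0 := by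
    simp only [f]
    rw [Finset.sum_sub_distrib, hf1, Finset.sum_const, Finset.card_univ, nsmul_eq_mul, hα]
    field_simp
    ring
  have hg0 : ∑ y, g y = 0 := by
    simp only [g]
    rw [Finset.sum_sub_distrib, hg1, Finset.sum_const, Finset.card_univ, nsmul_eq_mul, hβ]
    field_simp
    ring
  have hf2 : ∑ x, f x ^ 2 ≤ s := by
    -- In this form the part with `f` sums to zero, leaving s - s²/N.
    have h : ∀ x, f x ^ 2 = (1 - s / N) * (if x ∈ S then 1 else 0) - s / N * f x := fun x => by
      simp only [f]
      split_ifs <;> ring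
    rw [Finset.sum_congr rfl fun x _ => h x, Finset.sum_sub_distrib, ← Finset.mul_sum,
      ← Finset.mul_sum, hf1, hf0]
    have : 0 ≤ s / N * s := by positivity
    linarith
  have hg2 : ∑ y, g y ^ 2 ≤ t := by
    have h : ∀ y, g y ^ 2 = (1 - t / N) * (if y ∈ T then 1 else 0) - t / N * g y := fun y => by
      simp only [g]
      split_ifs <;> ring
    rw [Finset.sum_congr rfl fun y _ => h y, Finset.sum_sub_distrib, ← Finset.mul_sum,
      ← Finset.mul_sum, hg1, hg0]
    have : 0 ≤ t / N * t := by positivity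
    linarith
  have hfg : ∑ x, ∑ y, f x * g y * B x y = ∑ x ∈ S, ∑ y ∈ T, B x y - D * s * t / N := by
    have h1 : ∑ x, ∑ y, f x * g y * B x y =
        ∑ x, ∑ y, (if x ∈ S then 1 else 0) * g y * B x y - ∑ x, ∑ y, s / N * (g y * B x y) := by
      simp only [← Finset.sum_sub_distrib]
      exact Finset.sum_congr rfl fun x _ => Finset.sum_congr rfl fun y _ => by
        simp only [f]; ring
    have h2 : ∑ x, ∑ y, s / N * (g y * B x y) = 0 := by
      rw [Finset.sum_comm]
      simp only [← Finset.mul_sum, hcol, ← Finset.sum_mul, hg0]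
      simp
    have h3 : ∑ x, ∑ y, (if x ∈ S then 1 else 0) * g y * B x y =
        ∑ x ∈ S, ∑ y, g y * B x y := by
      rw [← Finset.sum_subset (Finset.subset_univ S)]
      · exact Finset.sum_congr rfl fun x hx => by simp [hx]
      · intro x _ hx
        simp [hx]
    have h4 : ∀ x, ∑ y, g y * B x y = ∑ y ∈ T, B x y - t / N * D := fun x => by
      simp only [g, sub_mul, Finset.sum_sub_distrib, ← Finset.mul_sum, hrow]
      simp
    rw [h1, h2, h3, Finset.sum_congr rfl fun x _ => h4 x, Finset.sum_sub_distrib,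
      Finset.sum_const, nsmul_eq_mul]
    simp only [s]
    ring
  -- rescale the two functions to have the same norm bound
  have h := hB (fun x => √t * f x) (fun y => √s * g y)
    (by rw [← Finset.mul_sum, hf0, mul_zero]) (by rw [← Finset.mul_sum, hg0, mul_zero])
  have e1 : ∑ x, ∑ y, √t * f x * (√s * g y) * B x y = √(s * t) * ∑ x, ∑ y, f x * g y * B x y := by
    rw [Real.sqrt_mul hs.le]
    simp only [Finset.mul_sum]
    exact Finset.sum_congr rfl fun x _ => Finset.sum_congr rfl fun y _ => by ring
  simp only [mul_pow, Real.sq_sqrt hs.le, Real.sq_sqrt ht.le, ← Finset.mul_sum] at h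
  rw [e1, hfg] at h
  have hst : 0 < √(s * t) := Real.sqrt_pos.2 (by positivity)
  have hsq : √(s * t) * √(s * t) = s * t := Real.mul_self_sqrt (by positivity)
  have h5 : l * (t * ∑ x, f x ^ 2 + s * ∑ y, g y ^ 2) ≤ l * (2 * (√(s * t) * √(s * t))) := by
    rw [hsq]
    refine mul_le_mul_of_nonneg_left ?_ hl
    nlinarith
  have h6 : √(s * t) * (∑ x ∈ S, ∑ y ∈ T, B x y - D * s * t / N) ≤
      √(s * t) * (l * √(s * t)) := by nlinarith
  have := le_of_mul_le_mul_left h6 hst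
  linarith

/-! ### The expander mixing lemma for bipartite graphs -/

namespace BipGraph

variable {H : BipGraph}

theorem sum_biadjMatrix_row {DL DR : ℕ} (h : H.IsBiregular DL DR) (x : H.L) :
    ∑ y, H.biadjMatrix x y = DL := by
  rw [← h.1 x x.2]
  simp only [biadjMatrix, Matrix.of_apply, nbrOfLeft]
  rw [Finset.sum_coe_sort H.R (fun y => if ((x : Str), y) ∈ H.E then (1 : ℝ) else 0),
    Finset.sum_boole]

theorem sum_biadjMatrix_col {DL DR : ℕ} (h : H.IsBiregular DL DR) (y : H.R) :
    ∑ x, H.biadjMatrix x y = DR := by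
  rw [← h.2 y y.2]
  simp only [biadjMatrix, Matrix.of_apply, nbrOfRight]
  rw [Finset.sum_coe_sort H.L (fun x => if (x, (y : Str)) ∈ H.E then (1 : ℝ) else 0),
    Finset.sum_boole]

/-- The second eigenvalue bounds the bilinear form of the biadjacency matrix on functions with
zero sum. -/
theorem two_mul_sum_le_secondEigenvalue {q : ℕ} (hreg : H.IsBiregular q q)
    (hcard : 1 < Fintype.card (H.L ⊕ H.R)) (hq : H.secondEigenvalue < q)
    (f : H.L → ℝ) (g : H.R → ℝ) (hf : ∑ x, f x = 0) (hg : ∑ y, g y = 0) :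
    2 * ∑ x, ∑ y, f x * g y * H.biadjMatrix x y ≤
      H.secondEigenvalue * (∑ x, f x ^ 2 + ∑ y, g y ^ 2) := by
  have hT := Matrix.isSymmetric_toEuclideanLin_iff.2 H.adjMatrix_isHermitian
  have hsec : H.secondEigenvalue = hT.eigenvalues finrank_euclideanSpace ⟨1, hcard⟩ := by
    rw [secondEigenvalue, dif_pos hcard]
    rfl
  have hne : Nonempty (H.L ⊕ H.R) := Fintype.card_pos_iff.1 (by omega)
  set u : EuclideanSpace ℝ (H.L ⊕ H.R) := WithLp.toLp 2 fun _ => 1 with hu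
  set z : EuclideanSpace ℝ (H.L ⊕ H.R) := WithLp.toLp 2 (Sum.elim f g) with hz
  have hu0 : u ≠ 0 := fun h => by
    obtain ⟨i⟩ := hne
    have := congrArg (fun v : EuclideanSpace ℝ (H.L ⊕ H.R) => v i) h
    simp [hu] at this
  -- The constant vector is an eigenvector for the degree `q`, which exceeds the second eigenvalue.
  have hTu : Matrix.toEuclideanLin H.adjMatrix u = (q : ℝ) • u := by
    ext i
    rw [Matrix.toLpLin_apply]
    rcases i with x | y
    · simpa [hu, adjMatrix, Matrix.mulVec, dotProduct] using sum_biadjMatrix_row hreg x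
    · simpa [hu, adjMatrix, Matrix.mulVec, dotProduct] using sum_biadjMatrix_col hreg y
  have hzu : inner ℝ z u = 0 := by
    have : inner ℝ z u = ∑ x, f x + ∑ y, g y := by
      simp [hu, hz, PiLp.inner_apply, Fintype.sum_sum_type]
    rw [this, hf, hg, add_zero]
  have h := hT.inner_le_of_inner_eq_zero finrank_euclideanSpace hcard hu0 hTu (hsec ▸ hq) hzu
  rw [← hsec] at h
  have e1 : inner ℝ z z = ∑ x, f x ^ 2 + ∑ y, g y ^ 2 := by
    simp only [hz, PiLp.inner_apply, Fintype.sum_sum_type, Sum.elim_inl, Sum.elim_inr,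
      RCLike.inner_apply, conj_trivial, sq]
  have e2 : inner ℝ (Matrix.toEuclideanLin H.adjMatrix z) z =
      2 * ∑ x, ∑ y, f x * g y * H.biadjMatrix x y := by
    simp only [hz, Matrix.toLpLin_apply, PiLp.inner_apply, Fintype.sum_sum_type, Sum.elim_inl,
      Sum.elim_inr, adjMatrix, Matrix.mulVec, dotProduct, Matrix.fromBlocks_apply₁₁,
      Matrix.fromBlocks_apply₁₂, Matrix.fromBlocks_apply₂₁, Matrix.fromBlocks_apply₂₂,
      Matrix.zero_apply, zero_mul, Finset.sum_const_zero, zero_add, add_zero,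
      Matrix.transpose_apply, RCLike.inner_apply, conj_trivial, Finset.mul_sum]
    rw [Finset.sum_comm (s := (Finset.univ : Finset H.R)), ← Finset.sum_add_distrib]
    refine Finset.sum_congr rfl fun x _ => ?_
    rw [← Finset.sum_add_distrib]
    exact Finset.sum_congr rfl fun y _ => by ring
  rwa [e1, e2] at h

/-- The expander mixing lemma for graphs with the parameters of a plane. -/
theorem card_le_of_isGoodExpander {q : ℕ} (hq : 0 < q) (hH : H.HasParams q 1)
    (hexp : H.IsGoodExpander) {F : Finset (Str × Str)} {S T : Finset Str} (hF : F ⊆ S ×ˢ T)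
    (hE : F ⊆ H.E) (hSL : S ⊆ H.L) (hTR : T ⊆ H.R) (hS : S.Nonempty) (hT : T.Nonempty) :
    (F.card : ℝ) ≤ S.card * T.card / q + √q * √(S.card * T.card) := by
  classical
  obtain ⟨hL, hR, hreg⟩ := hH
  rw [pow_one] at hreg
  -- For `q = 1` the strict inequality √q < q fails, but the trivial bound |S||T| suffices.
  rcases Nat.eq_or_lt_of_le (Nat.succ_le_of_lt hq) with rfl | hq1
  · have h1 : (F.card : ℝ) ≤ S.card * T.card := by
      exact_mod_cast (Finset.card_le_card hF).trans (Finset.card_product S T).le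
    have h2 : (0 : ℝ) ≤ √((1 : ℕ) : ℝ) * √(S.card * T.card) := by positivity
    simpa using h1.trans (le_add_of_nonneg_right h2)
  · have hq' : (1 : ℝ) < q := by exact_mod_cast hq1
    obtain ⟨DL, DR, hreg', hsec⟩ := hexp
    obtain ⟨x₀, hx₀⟩ := hS
    obtain ⟨y₀, hy₀⟩ := hT
    obtain rfl : DL = q := (hreg'.1 x₀ (hSL hx₀)).symm.trans (hreg.1 x₀ (hSL hx₀))
    obtain rfl : DR = DL := (hreg'.2 y₀ (hTR hy₀)).symm.trans (hreg.2 y₀ (hTR hy₀))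
    rw [max_self] at hsec
    have hcard : 1 < Fintype.card (H.L ⊕ H.R) := by
      rw [Fintype.card_sum, Fintype.card_coe, Fintype.card_coe, hL]
      nlinarith
    have hlt : H.secondEigenvalue < DR := hsec.trans_lt (by
      rw [Real.sqrt_lt' (by positivity)]
      nlinarith)
    have h := sum_le_of_quadratic_bound (B := H.biadjMatrix) (N := (DR : ℝ) ^ 2) (D := DR)
      (l := √DR) (by positivity) (by rw [Fintype.card_coe, hL]; push_cast; rfl)
      (by rw [Fintype.card_coe, hR]; push_cast; rfl) (sum_biadjMatrix_row hreg)
      (sum_biadjMatrix_col hreg) (Real.sqrt_nonneg _)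
      (fun f g hf hg => (two_mul_sum_le_secondEigenvalue hreg hcard hlt f g hf hg).trans
        (mul_le_mul_of_nonneg_right hsec (by positivity)))
      (S.subtype (· ∈ H.L)) (T.subtype (· ∈ H.R)) ⟨⟨x₀, hSL hx₀⟩, by simpa using hx₀⟩
      ⟨⟨y₀, hTR hy₀⟩, by simpa using hy₀⟩
    have cS : (S.subtype (· ∈ H.L)).card = S.card := by
      rw [Finset.card_subtype, Finset.filter_true_of_mem fun x hx => hSL hx]
    have cT : (T.subtype (· ∈ H.R)).card = T.card := by
      rw [Finset.card_subtype, Finset.filter_true_of_mem fun x hx => hTR hx]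
    rw [cS, cT] at h
    have hFle : (F.card : ℝ) ≤
        ∑ x ∈ S.subtype (· ∈ H.L), ∑ y ∈ T.subtype (· ∈ H.R), H.biadjMatrix x y := by
      have h1 : F ⊆ (S ×ˢ T).filter fun z => z ∈ H.E := fun z hz =>
        Finset.mem_filter.2 ⟨hF hz, hE hz⟩
      have h2 : (((S ×ˢ T).filter fun z => z ∈ H.E).card : ℝ) =
          ∑ x ∈ S, ∑ y ∈ T, if (x, y) ∈ H.E then (1 : ℝ) else 0 := by
        rw [← Finset.sum_boole, Finset.sum_product]
      have h3 : ∑ x ∈ S.subtype (· ∈ H.L), ∑ y ∈ T.subtype (· ∈ H.R), H.biadjMatrix x y =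
          ∑ x ∈ S, ∑ y ∈ T, if (x, y) ∈ H.E then (1 : ℝ) else 0 := by
        simp only [biadjMatrix, Matrix.of_apply]
        rw [Finset.sum_subtype_of_mem (fun x => ∑ y ∈ T.subtype (· ∈ H.R),
          if (x, (y : Str)) ∈ H.E then (1 : ℝ) else 0) fun x hx => hSL hx]
        refine Finset.sum_congr rfl fun x _ => ?_
        exact Finset.sum_subtype_of_mem (fun y => if (x, y) ∈ H.E then (1 : ℝ) else 0)
          fun y hy => hTR hy
      rw [h3, ← h2]
      exact_mod_cast Finset.card_le_card h1
    refine hFle.trans (h.trans (le_of_eq ?_))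
    congr 1
    field_simp

end BipGraph

theorem logb_two_le_of_le_two_mul {a b : ℝ} (ha : 0 < a) (hb : 0 < b) (h : a ≤ 2 * b) :
    Real.logb 2 a ≤ 1 + Real.logb 2 b := by
  have := Real.logb_le_logb_of_le one_lt_two ha h
  rwa [Real.logb_mul two_ne_zero hb.ne', Real.logb_self_eq_one one_lt_two] at this

theorem logb_sq_two (a : ℝ) : Real.logb 2 (a ^ 2) = 2 * Real.logb 2 a := by
  simpa using Real.logb_pow 2 a 2

theorem lg_le_add_one (N : ℕ) : lg N ≤ N + 1 := by
  rw [lg, Real.logb_le_iff_le_rpow one_lt_two (by positivity)]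
  have h1 : N + 2 ≤ 2 ^ (N + 1) := Nat.succ_le_of_lt Nat.lt_two_pow_self
  have h2 : ((N : ℝ) + 2) ≤ 2 ^ (N + 1) := by exact_mod_cast h1
  rw [show ((N : ℝ) + 1) = ((N + 1 : ℕ) : ℝ) by push_cast; rfl, Real.rpow_natCast]
  exact h2

/-! ### From edge counts to complexity inequalities -/

namespace IsOptimal

variable {U : Machine}

/-- The strings of a finite set that have complexity at most `k`. -/
theorem card_filter_KC_le (hU : IsOptimal U) (V : Finset Str) (k : ℕ) (ys : List Str) :
    (V.filter fun x => KC U [x] ys ≤ k).card ≤ 2 ^ (k + 1) := by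
  classical
  obtain ⟨s, hs, hmem⟩ := hU.exists_finset_KC_le k ys
  refine le_trans ?_ hs.le
  refine Finset.card_le_card_of_injOn (fun x => [x]) (fun x hx => ?_) fun x _ y _ h => by
    simpa using h
  exact (hmem _).2 (Finset.mem_filter.1 hx).2

/-- The complexity of an edge relative to a string is bounded by the logarithm of the number of
edges between two sets that have about as many elements as the complexities of its endpoints
allow. -/
theorem exists_edge_sets (hU : IsOptimal U) {G : ℕ → BipGraph} (hG : BipGraph.IsExplicit G)
    (κ : ℕ) : ∃ c : ℝ, 0 ≤ c ∧ ∀ k x y w (N : ℕ), (x, y) ∈ (G k).E → k ≤ κ * (N + 1) →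
      x.length + y.length ≤ N →
      ∃ (F : Finset (Str × Str)) (S T : Finset Str), F ⊆ (G k).E ∧ F ⊆ S ×ˢ T ∧ S ⊆ (G k).L ∧
        T ⊆ (G k).R ∧ 0 < F.card ∧ 0 < S.card ∧ 0 < T.card ∧
        Real.logb 2 S.card ≤ KC U [x] [w] + 1 ∧ Real.logb 2 T.card ≤ KC U [y] [w] + 1 ∧
        (KC U [x, y] [w] : ℝ) ≤ Real.logb 2 F.card + c * lg N := by
  classical
  obtain ⟨a, ha⟩ := hU.exists_KC_le_length 1
  obtain ⟨c₁, hc₁, h₁⟩ := exists_size_le_lg (max a κ)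
  obtain ⟨c₂, h₂⟩ := hU.exists_KC_edge_le hG
  refine ⟨60 * c₁ + c₂ + 1, by positivity, fun k x y w N hxy hk hN => ?_⟩
  set S := (G k).L.filter fun x' => KC U [x'] [w] ≤ KC U [x] [w] with hS
  set T := (G k).R.filter fun y' => KC U [y'] [w] ≤ KC U [y] [w] with hT
  set F := (G k).E.filter fun z => z ∈ S ×ˢ T with hF
  have hmem : ∀ x' y', (x', y') ∈ (G k).E → KC U [x'] [w] ≤ KC U [x] [w] →
      KC U [y'] [w] ≤ KC U [y] [w] → (x', y') ∈ F := by
    intro x' y' h hx hy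
    have hLR := Finset.mem_product.1 ((G k).edges_subset h)
    exact Finset.mem_filter.2 ⟨h, Finset.mem_product.2
      ⟨Finset.mem_filter.2 ⟨hLR.1, hx⟩, Finset.mem_filter.2 ⟨hLR.2, hy⟩⟩⟩
  -- The edge itself makes all three sets nonempty, so their logarithms are meaningful.
  have hxyF : (x, y) ∈ F := hmem x y hxy le_rfl le_rfl
  have hxyST := Finset.mem_product.1 (Finset.mem_filter.1 hxyF).2
  have hlog : ∀ (V : Finset Str) (b : ℕ), 0 < V.card → V.card ≤ 2 ^ (b + 1) →
      Real.logb 2 V.card ≤ b + 1 := by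
    intro V b hpos hle
    have h1 : (V.card : ℝ) ≤ 2 ^ (b + 1) := by exact_mod_cast hle
    rw [Real.logb_le_iff_le_rpow one_lt_two (by exact_mod_cast hpos)]
    rwa [show ((b : ℝ) + 1) = ((b + 1 : ℕ) : ℝ) by push_cast; rfl, Real.rpow_natCast]
  have hFpos : 0 < F.card := Finset.card_pos.2 ⟨_, hxyF⟩
  have hSpos : 0 < S.card := Finset.card_pos.2 ⟨_, hxyST.1⟩
  have hTpos : 0 < T.card := Finset.card_pos.2 ⟨_, hxyST.2⟩
  refine ⟨F, S, T, Finset.filter_subset _ _, fun z hz => (Finset.mem_filter.1 hz).2,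
    Finset.filter_subset _ _, Finset.filter_subset _ _, hFpos, hSpos, hTpos,
    hlog S _ hSpos (hU.card_filter_KC_le _ _ _), hlog T _ hTpos (hU.card_filter_KC_le _ _ _), ?_⟩
  have hb : ∀ v : Str, v.length ≤ N → KC U [v] [w] ≤ max a κ * (N + 1) := fun v hv =>
    (ha [v] [w] rfl).trans (Nat.mul_le_mul (le_max_left _ _) (by simpa using hv))
  have e₁ := h₁ k N (hk.trans (Nat.mul_le_mul_right _ (le_max_right _ _)))
  have e₂ := h₁ _ N (hb x (by omega))
  have e₃ := h₁ _ N (hb y (by omega))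
  have e₄ : (KC U [x, y] [w] : ℝ) ≤
      F.card.size + 20 * (k.size + (KC U [x] [w]).size + (KC U [y] [w]).size) + c₂ := by
    exact_mod_cast h₂ k x y w F hxy hmem
  have e₅ := size_le_logb_add_one hFpos.ne'
  have hl := one_le_lg N
  have hc₂ : (c₂ : ℝ) ≤ c₂ * lg N := le_mul_of_one_le_right (by positivity) hl
  linarith

/-- In a graph with `1`-bounded common neighborhood on the right, an edge relative to any string is
either about as simple as its left end, or at most as complex as the extremal number of edges
suggests. -/
theorem exists_KC_edge_le_of_boundedCommonNbhd (hU : IsOptimal U) {G : ℕ → BipGraph}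
    (hG : BipGraph.IsExplicit G) (κ : ℕ) : ∃ c : ℝ, 0 ≤ c ∧ ∀ k x y w (N : ℕ),
      (x, y) ∈ (G k).E → k ≤ κ * (N + 1) → x.length + y.length ≤ N →
      (G k).BoundedCommonNbhd 1 →
      (KC U [x, y] [w] : ℝ) ≤ KC U [x] [w] + c * lg N ∨
        2 * (KC U [x, y] [w] : ℝ) ≤ KC U [x] [w] + 2 * KC U [y] [w] + c * lg N := by
  obtain ⟨c, hc, h⟩ := hU.exists_edge_sets hG κ
  refine ⟨2 * c + 4, by positivity, fun k x y w N hxy hk hN hb => ?_⟩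
  obtain ⟨F, S, T, hFE, hFST, -, -, hF, hS, hT, hlS, hlT, hle⟩ := h k x y w N hxy hk hN
  have hsq := hb.card_sq_le hFE hFST
  have hl := one_le_lg N
  have hcl : 0 ≤ c * lg N := by positivity
  have hF' : (0 : ℝ) < F.card := by exact_mod_cast hF
  have hS' : (0 : ℝ) < S.card := by exact_mod_cast hS
  have hT' : (0 : ℝ) < T.card := by exact_mod_cast hT
  -- The larger of the two summands |T|² and |F| decides which alternative holds, at the cost of a
  -- factor 2.
  rcases le_total F.card (T.card ^ 2) with hFT | hFT
  · right
    have h1 : F.card ^ 2 ≤ 2 * (S.card * T.card ^ 2) := by nlinarith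
    have h2 : (F.card : ℝ) ^ 2 ≤ 2 * (S.card * (T.card : ℝ) ^ 2) := by exact_mod_cast h1
    have h3 := logb_two_le_of_le_two_mul (by positivity) (by positivity) h2
    rw [Real.logb_mul (by positivity) (by positivity), logb_sq_two, logb_sq_two] at h3
    linarith
  · left
    have h1 : F.card * F.card ≤ F.card * (2 * S.card) := by nlinarith
    have h2 : (F.card : ℝ) ≤ 2 * S.card := by exact_mod_cast Nat.le_of_mul_le_mul_left h1 hF
    have h3 := logb_two_le_of_le_two_mul hF' hS' h2
    linarith

/-- In a good expander, the complexity of an edge relative to any string is at most as large as the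
expander mixing lemma suggests. -/
theorem exists_KC_edge_le_of_isGoodExpander (hU : IsOptimal U) {G : ℕ → BipGraph}
    (hG : BipGraph.IsExplicit G) (κ : ℕ) : ∃ c : ℝ, 0 ≤ c ∧ ∀ k q x y w (N : ℕ),
      0 < q → (G k).HasParams q 1 →
      (x, y) ∈ (G k).E → k ≤ κ * (N + 1) → x.length + y.length ≤ N →
      (G k).IsGoodExpander →
      (KC U [x, y] [w] : ℝ) + Real.logb 2 q ≤ KC U [x] [w] + KC U [y] [w] + c * lg N ∨
        2 * (KC U [x, y] [w] : ℝ) ≤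
          Real.logb 2 q + KC U [x] [w] + KC U [y] [w] + c * lg N := by
  obtain ⟨c, hc, h⟩ := hU.exists_edge_sets hG κ
  refine ⟨2 * c + 4, by positivity, fun k q x y w N hq hpar hxy hk hN hexp => ?_⟩
  obtain ⟨F, S, T, hFE, hFST, hSL, hTR, hF, hS, hT, hlS, hlT, hle⟩ := h k x y w N hxy hk hN
  have hmix := BipGraph.card_le_of_isGoodExpander hq hpar hexp hFST hFE hSL hTR
    (Finset.card_pos.1 hS) (Finset.card_pos.1 hT)
  have hl := one_le_lg N
  have hcl : 0 ≤ c * lg N := by positivity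
  have hF' : (0 : ℝ) < F.card := by exact_mod_cast hF
  have hS' : (0 : ℝ) < S.card := by exact_mod_cast hS
  have hT' : (0 : ℝ) < T.card := by exact_mod_cast hT
  have hq' : (0 : ℝ) < q := by exact_mod_cast hq
  rw [← Real.sqrt_mul hq'.le] at hmix
  -- The alternatives are that the main term or the spectral error term dominates.
  rcases le_total (√(q * (S.card * T.card : ℝ))) (S.card * T.card / q) with hc | hc
  · left
    have h3 := logb_two_le_of_le_two_mul hF' (b := S.card * T.card / q) (by positivity)
      (by linarith)
    rw [Real.logb_div (by positivity) (by positivity),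
      Real.logb_mul (by positivity) (by positivity)] at h3
    linarith
  · right
    have h3 := logb_two_le_of_le_two_mul hF' (b := √(q * (S.card * T.card : ℝ))) (by positivity)
      (by linarith)
    have h4 := logb_sq_two (√(q * (S.card * T.card : ℝ)))
    rw [Real.sq_sqrt (by positivity), Real.logb_mul (by positivity) (by positivity),
      Real.logb_mul (by positivity) (by positivity)] at h4
    linarith

/-- The parameter of a graph with a typical edge is at most linear in the length of the edge. -/
theorem exists_logb_le_of_isTypicalEdge (hU : IsOptimal U) (t : ℝ) :
    ∃ κ : ℕ, ∀ (H : BipGraph) (q d : ℕ) (x y : Str) (N : ℕ), H.IsTypicalEdge U t q d x y →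
      x.length + y.length ≤ N → Real.logb 2 q ≤ κ * (N + 1) := by
  obtain ⟨a, ha⟩ := hU.exists_KC_le_length 1
  refine ⟨a + ⌈|t|⌉₊, fun H q d x y N htyp hN => ?_⟩
  have h1 := (abs_le.1 htyp.2.1).1
  have h2 : (KC U [x] [] : ℝ) ≤ a * (N + 1) := by
    have : KC U [x] [] ≤ a * (N + 1) := (ha [x] [] rfl).trans
      (Nat.mul_le_mul_left _ (by rw [totalLength_cons, totalLength_nil]; omega))
    exact_mod_cast this
  have h3 : t * logTerm [x, y] ≤ ⌈|t|⌉₊ * (N + 1) := by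
    have h4 : logTerm [x, y] ≤ N + 1 := (lg_mono (by simpa using hN)).trans (lg_le_add_one N)
    have h5 : 0 ≤ logTerm [x, y] := zero_le_one.trans (one_le_lg _)
    calc t * logTerm [x, y] ≤ |t| * logTerm [x, y] := by gcongr; exact le_abs_self t
      _ ≤ ⌈|t|⌉₊ * (N + 1) := by gcongr; exact Nat.le_ceil _
  have h6 : (0 : ℝ) ≤ a * (N + 1) := by positivity
  have h7 : (0 : ℝ) ≤ ⌈|t|⌉₊ * (N + 1) := by positivity
  push_cast
  linarith

/-- The inequalities between the complexities of a typical edge and its ends relative to a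
string. -/
theorem exists_typicalEdge_le (hU : IsOptimal U) {G : ℕ → BipGraph} (hG : BipGraph.IsExplicit G)
    (t : ℝ) : ∃ c : ℝ, 0 ≤ c ∧ ∀ k q x y w (N : ℕ), Nat.log 2 q = k → (G k).HasParams q 1 →
      (G k).IsTypicalEdge U t q 1 x y → x.length + y.length ≤ N →
      ((G k).BoundedCommonNbhd 1 → 3 * (KC U [x, y] [w] : ℝ) ≤
        Real.logb 2 q + 2 * KC U [x] [w] + 2 * KC U [y] [w] + c * lg N) ∧
      ((G k).IsGoodExpander → (KC U [w] [] : ℝ) ≤ Real.logb 2 q →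
        (KC U [x, y] [w] : ℝ) + Real.logb 2 q ≤ KC U [x] [w] + KC U [y] [w] + c * lg N) := by
  obtain ⟨κ, hκ⟩ := hU.exists_logb_le_of_isTypicalEdge t
  obtain ⟨c₁, hc₁, h₁⟩ := hU.exists_KC_edge_le_of_boundedCommonNbhd hG κ
  obtain ⟨c₂, hc₂, h₂⟩ := hU.exists_KC_edge_le_of_isGoodExpander hG κ
  obtain ⟨c₃, hc₃, h₃⟩ := hU.exists_chain_le 1 1
  obtain ⟨c₄, hc₄, h₄⟩ := hU.exists_le_chain 1 1 0
  obtain ⟨c₅, hc₅, h₅⟩ := hU.exists_rearrange_le Computable.id (computable_pick [1])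
  obtain ⟨c₆, hc₆, h₆⟩ := hU.exists_rearrange_le (computable_pick [1, 0]) Computable.id
  obtain ⟨c₇, hc₇, h₇⟩ := exists_size_le_lg κ
  obtain ⟨c₈, h₈⟩ := hU.exists_KC_append_le
  obtain ⟨c₉, hc₉, h₉⟩ := hU.exists_rearrange_le (computable_pick [1, 2]) Computable.id
  refine ⟨10 * (c₁ + c₂ + c₃ + c₄ + c₅ + c₆ + c₇ + c₈ + c₉ + |t|), by positivity,
    fun k q x y w N hqk hpar htyp hN => ?_⟩
  have hl := one_le_lg N
  have hkn : (k : ℝ) ≤ Real.logb 2 q := hqk ▸ Real.natLog_le_logb q 2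
  have hn := hκ _ _ _ _ _ N htyp hN
  have hk : k ≤ κ * (N + 1) := by exact_mod_cast hkn.trans hn
  obtain ⟨hE, hx, hy, hxy⟩ := htyp
  -- For `q = 0` there would be no left vertices, hence no edge.
  have hq : 0 < q := by
    rcases Nat.eq_zero_or_pos q with rfl | h
    · have hxL := (Finset.mem_product.1 ((G k).edges_subset hE)).1
      have hL : (G k).L = ∅ := Finset.card_eq_zero.1 (by rw [hpar.1]; norm_num)
      rw [hL] at hxL
      exact absurd hxL (Finset.notMem_empty _)
    · exact h
  have hlog : t * logTerm [x, y] ≤ |t| * lg N := by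
    have h1 : logTerm [x, y] ≤ lg N := lg_mono (by simpa using hN)
    have h2 : 0 ≤ logTerm [x, y] := zero_le_one.trans (one_le_lg _)
    calc t * logTerm [x, y] ≤ |t| * logTerm [x, y] := by gcongr; exact le_abs_self t
      _ ≤ |t| * lg N := by gcongr
  have hx' := abs_le.1 (hx.trans hlog)
  have hy' := abs_le.1 (hy.trans hlog)
  have hxy' := abs_le.1 (hxy.trans hlog)
  push_cast at hx' hy' hxy'
  set n := Real.logb 2 q
  have p₁ : 0 ≤ c₁ * lg N := by positivity
  have p₂ : 0 ≤ c₂ * lg N := by positivity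
  have p₃ : 0 ≤ c₃ * lg N := by positivity
  have p₄ : 0 ≤ c₄ * lg N := by positivity
  have p₅ : 0 ≤ c₅ * lg N := by positivity
  have p₆ : 0 ≤ c₆ * lg N := by positivity
  have p₇ : 0 ≤ c₇ * lg N := by positivity
  have p₈ : (c₈ : ℝ) ≤ c₈ * lg N := le_mul_of_one_le_right (by positivity) hl
  have p₈' : 0 ≤ (c₈ : ℝ) * lg N := by positivity
  have p₉ : 0 ≤ c₉ * lg N := by positivity
  have p₀ : 0 ≤ |t| * lg N := by positivity
  refine ⟨fun hb => ?_, fun hexp hw => ?_⟩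
  · have a₁ := h₁ k x y w N hE hk hN hb
    -- an end of the edge determines the edge up to `n` bits
    have a₂ : (KC U [x, y] [w] : ℝ) ≤ KC U [x] [w] + KC U [y] [w, x] + c₃ * lg N :=
      h₃ [x] [y] [w] N rfl rfl (by rw [totalLength_cons, totalLength_nil]; omega)
    have a₃ : (KC U [y, x] [w] : ℝ) ≤ KC U [y] [w] + KC U [x] [w, y] + c₃ * lg N :=
      h₃ [y] [x] [w] N rfl rfl (by rw [totalLength_cons, totalLength_nil]; omega)
    have a₄ : (KC U [x, y] [w] : ℝ) ≤ KC U [y, x] [w] + c₆ * lg N := h₆ [y, x] [w] N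
    have a₅ : (KC U [y] [w, x] : ℝ) ≤ KC U [y] [x] + c₅ * lg N := h₅ [y] [w, x] N
    have a₆ : (KC U [x] [w, y] : ℝ) ≤ KC U [x] [y] + c₅ * lg N := h₅ [x] [w, y] N
    have a₇ : (KC U [x] [] + KC U [y] [x] : ℝ) ≤ KC U [x, y] [] + c₄ * lg N :=
      h₄ [x] [y] [] N rfl rfl rfl (by simpa using hN)
    have a₈ : (KC U [y] [] + KC U [x] [y] : ℝ) ≤ KC U [y, x] [] + c₄ * lg N :=
      h₄ [y] [x] [] N rfl rfl rfl (by simpa [add_comm] using hN)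
    have a₉ : (KC U [y, x] [] : ℝ) ≤ KC U [x, y] [] + c₆ * lg N := h₆ [x, y] [] N
    -- If e ≤ a, double this and add e ≤ b + n. If 2e ≤ a + 2b, add e ≤ a + n.
    rcases a₁ with a₁ | a₁ <;> linarith
  · have a₁ := h₂ k q x y w N hq hpar hE hk hN hexp
    have hwN : KC U [w] [] ≤ κ * (N + 1) := by exact_mod_cast hw.trans hn
    have a₂ := h₇ _ N hwN
    have a₃ : (KC U [w, x, y] [] : ℝ) ≤
        KC U [w] [] + KC U [x, y] [w] + 2 * (KC U [w] []).size + c₈ := by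
      exact_mod_cast h₈ [w] [x, y] []
    have a₄ : (KC U [x, y] [] : ℝ) ≤ KC U [w, x, y] [] + c₉ * lg N := h₉ [w, x, y] [] N
    -- In the second alternative, subtract 2n ≤ e, which follows from 3n ≤ C(w) + e and C(w) ≤ n.
    rcases a₁ with a₁ | a₁ <;> linarith

/-- Bounds for the conditional complexities of a pair of extended tuples. -/
theorem exists_extended_chain (hU : IsOptimal U) (s : ℕ) : ∃ c : ℝ, 0 ≤ c ∧
    ∀ (x y w : Str) (rs ss : List Str) (N : ℕ), rs.length = s → ss.length = s →
      x.length + y.length + totalLength rs + totalLength ss ≤ N →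
      (KC U (([y] ++ ss) ++ ([x] ++ rs)) [] : ℝ) ≤
        KC U [y] [] + KC U ss [] + KC U ([x] ++ rs) ([y] ++ ss) + c * lg N ∧
      (KC U [y] [w] + KC U ss [w, y] + KC U ([x] ++ rs) ([w] ++ ([y] ++ ss)) : ℝ) ≤
        KC U (([y] ++ ss) ++ ([x] ++ rs)) [w] + c * lg N := by
  obtain ⟨c₁, hc₁, h₁⟩ := hU.exists_chain_le (s + 1) 0
  obtain ⟨c₂, hc₂, h₂⟩ := hU.exists_chain_le 1 0
  obtain ⟨c₃, hc₃, h₃⟩ := hU.exists_rearrange_le Computable.id (Computable.const [])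
  obtain ⟨c₄, hc₄, h₄⟩ := hU.exists_le_chain (s + 1) (s + 1) 1
  obtain ⟨c₅, hc₅, h₅⟩ := hU.exists_le_chain 1 s 1
  refine ⟨c₁ + c₂ + c₃ + c₄ + c₅, by positivity, fun x y w rs ss N hr hs hN => ?_⟩
  have hl := one_le_lg N
  have p₁ : 0 ≤ c₁ * lg N := by positivity
  have p₂ : 0 ≤ c₂ * lg N := by positivity
  have p₃ : 0 ≤ c₃ * lg N := by positivity
  have p₄ : 0 ≤ c₄ * lg N := by positivity
  have p₅ : 0 ≤ c₅ * lg N := by positivity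
  constructor
  · have a₁ := h₁ ([y] ++ ss) ([x] ++ rs) [] N (by simp [hs]) rfl (by simp; omega)
    have a₂ := h₂ [y] ss [] N rfl rfl (by simp; omega)
    have a₃ := h₃ ss [y] N
    simp only [List.nil_append, id] at a₁ a₂ a₃
    linarith
  · have a₄ := h₄ ([y] ++ ss) ([x] ++ rs) [w] N (by simp [hs]) (by simp [hr]) rfl
      (by simp; omega)
    have a₅ : (KC U [y] [w] + KC U ss [w, y] : ℝ) ≤ KC U ([y] ++ ss) [w] + c₅ * lg N :=
      h₅ [y] ss [w] N rfl hs rfl (by simp; omega)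
    linarith

/-- The complexity of an edge with additional strings, relative to a string. -/
theorem exists_KC_edge_append_le (hU : IsOptimal U) (s : ℕ) : ∃ c : ℝ, 0 ≤ c ∧
    ∀ (x y w : Str) (rs ss : List Str) (N : ℕ), rs.length = s →
      x.length + y.length + totalLength rs + totalLength ss ≤ N →
      (KC U ([x, y] ++ (rs ++ ss)) [w] : ℝ) ≤
        KC U [x, y] [w] + KC U rs [w, x] + KC U ss [w, y] + c * lg N ∧
      (KC U rs [w, x] : ℝ) ≤ KC U rs [] + c * lg N ∧
      (KC U ss [w, y] : ℝ) ≤ KC U ss [] + c * lg N := by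
  obtain ⟨c₁, hc₁, h₁⟩ := hU.exists_chain_le 2 1
  obtain ⟨c₂, hc₂, h₂⟩ := hU.exists_chain_le s 3
  obtain ⟨c₃, hc₃, h₃⟩ := hU.exists_rearrange_le Computable.id (computable_pick [0, 1])
  obtain ⟨c₄, hc₄, h₄⟩ := hU.exists_rearrange_le Computable.id (computable_pick [0, 2])
  obtain ⟨c₅, hc₅, h₅⟩ := hU.exists_rearrange_le Computable.id (Computable.const [])
  refine ⟨c₁ + c₂ + c₃ + c₄ + c₅, by positivity, fun x y w rs ss N hr hN => ?_⟩
  have hl := one_le_lg N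
  have p₁ : 0 ≤ c₁ * lg N := by positivity
  have p₂ : 0 ≤ c₂ * lg N := by positivity
  have p₃ : 0 ≤ c₃ * lg N := by positivity
  have p₄ : 0 ≤ c₄ * lg N := by positivity
  have p₅ : 0 ≤ c₅ * lg N := by positivity
  have a₁ := h₁ [x, y] (rs ++ ss) [w] N rfl rfl (by simp; omega)
  have a₂ := h₂ rs ss ([w] ++ [x, y]) N hr rfl (by omega)
  have a₃ : (KC U rs ([w] ++ [x, y]) : ℝ) ≤ KC U rs [w, x] + c₃ * lg N := h₃ rs [w, x, y] N
  have a₄ : (KC U ss ([w] ++ [x, y] ++ rs) : ℝ) ≤ KC U ss [w, y] + c₄ * lg N :=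
    h₄ ss ([w, x, y] ++ rs) N
  have a₅ : (KC U rs [w, x] : ℝ) ≤ KC U rs [] + c₅ * lg N := h₅ rs [w, x] N
  have a₆ : (KC U ss [w, y] : ℝ) ≤ KC U ss [] + c₅ * lg N := h₅ ss [w, y] N
  refine ⟨?_, ?_, ?_⟩ <;> linarith

/-- The orders in which an edge and its additional strings are listed do not matter. -/
theorem exists_KC_edge_rearrange (hU : IsOptimal U) (s : ℕ) : ∃ c : ℝ, 0 ≤ c ∧
    ∀ (x y : Str) (rs ss ws : List Str) (N : ℕ), rs.length = s → ss.length = s →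
      (KC U ([x, y] ++ (rs ++ ss)) ws : ℝ) ≤ KC U (([y] ++ ss) ++ ([x] ++ rs)) ws + c * lg N ∧
      (KC U (([y] ++ ss) ++ ([x] ++ rs)) ws : ℝ) ≤ KC U ([x, y] ++ (rs ++ ss)) ws + c * lg N ∧
      (KC U ([x, y] ++ (rs ++ ss)) ws : ℝ) ≤ KC U (([x] ++ rs) ++ ([y] ++ ss)) ws + c * lg N ∧
      (KC U (([x] ++ rs) ++ ([y] ++ ss)) ws : ℝ) ≤ KC U ([x, y] ++ (rs ++ ss)) ws + c * lg N := by
  have slice : ∀ a b : ℕ, Computable fun l : List Str => (l.drop a).take b := fun a b =>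
    Primrec.list_take.to_comp.comp (Computable.const b)
      (Primrec.list_drop.to_comp.comp (Computable.const a) Computable.id)
  -- Each reordering concatenates four slices, given by offset and length; the offsets are known
  -- because both additional tuples have length `s`.
  have slices : ∀ a b a₁ b₁ a₂ b₂ a₃ b₃ : ℕ, Computable fun l : List Str =>
      ((l.drop a).take b ++ (l.drop a₁).take b₁) ++
        ((l.drop a₂).take b₂ ++ (l.drop a₃).take b₃) := fun a b a₁ b₁ a₂ b₂ a₃ b₃ =>
    Computable.list_append.comp (Computable.list_append.comp (slice a b) (slice a₁ b₁))
      (Computable.list_append.comp (slice a₂ b₂) (slice a₃ b₃))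
  obtain ⟨c₁, hc₁, h₁⟩ := hU.exists_rearrange_le
    (slices (s + 1) 1 0 1 (s + 2) s 1 s) Computable.id
  obtain ⟨c₂, hc₂, h₂⟩ := hU.exists_rearrange_le
    (slices 1 1 (s + 2) s 0 1 2 s) Computable.id
  obtain ⟨c₃, hc₃, h₃⟩ := hU.exists_rearrange_le
    (slices 0 1 (s + 1) 1 1 s (s + 2) s) Computable.id
  obtain ⟨c₄, hc₄, h₄⟩ := hU.exists_rearrange_le
    (slices 0 1 2 s 1 1 (s + 2) s) Computable.id
  refine ⟨c₁ + c₂ + c₃ + c₄, by positivity, fun x y rs ss ws N hr hs => ?_⟩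
  have hl := one_le_lg N
  have p₁ : 0 ≤ c₁ * lg N := by positivity
  have p₂ : 0 ≤ c₂ * lg N := by positivity
  have p₃ : 0 ≤ c₃ * lg N := by positivity
  have p₄ : 0 ≤ c₄ * lg N := by positivity
  have a₁ := h₁ (([y] ++ ss) ++ ([x] ++ rs)) ws N
  have a₂ := h₂ ([x, y] ++ (rs ++ ss)) ws N
  have a₃ := h₃ (([x] ++ rs) ++ ([y] ++ ss)) ws N
  have a₄ := h₄ ([x, y] ++ (rs ++ ss)) ws N
  have tr : rs.take s = rs := List.take_of_length_le hr.le
  have ts : ss.take s = ss := List.take_of_length_le hs.le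
  have dr : rs.drop (s + 1) = [] := List.drop_eq_nil_of_le (by omega)
  have ds : ss.drop (s + 1) = [] := List.drop_eq_nil_of_le (by omega)
  simp [List.drop_append, List.take_append, hr, hs, tr, ts, dr, ds] at a₁ a₂ a₃ a₄
  simp only [List.cons_append, List.nil_append]
  refine ⟨?_, ?_, ?_, ?_⟩ <;> linarith

end IsOptimal

/-! ### Information inequalities -/

namespace IsOptimal

variable {U : Machine}

/-- The information inequalities for an edge with additional independent strings follow from the
inequalities between the complexities of the edge and its ends relative to a string. -/
theorem exists_MI_le (hU : IsOptimal U) (s : ℕ) (t : ℝ) : ∃ c : ℝ, 0 ≤ c ∧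
    ∀ (n e : ℝ) (x y w : Str) (rs ss : List Str) (N : ℕ), rs.length = s → ss.length = s →
      x.length + y.length + totalLength rs + totalLength ss ≤ N →
      |(KC U [x] [] : ℝ) - 2 * n| ≤ t * lg N → |(KC U [y] [] : ℝ) - 2 * n| ≤ t * lg N →
      |(KC U [x, y] [] : ℝ) - 3 * n| ≤ t * lg N →
      |(KC U ([x, y] ++ (rs ++ ss)) [] : ℝ) - (KC U [x, y] [] + KC U rs [] + KC U ss [])|
        ≤ t * lg N →
      (3 * (KC U [x, y] [w] : ℝ) ≤ n + 2 * KC U [x] [w] + 2 * KC U [y] [w] + e →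
        MI U [w] ([x, y] ++ (rs ++ ss)) [] ≤ 2 * MI U [w] ([x] ++ rs) ([y] ++ ss) +
          2 * MI U [w] ([y] ++ ss) ([x] ++ rs) + e + c * lg N) ∧
      ((KC U [x, y] [w] : ℝ) + n ≤ KC U [x] [w] + KC U [y] [w] + e →
        MI U [w] ([x, y] ++ (rs ++ ss)) [] ≤ MI U [w] ([x] ++ rs) ([y] ++ ss) +
          MI U [w] ([y] ++ ss) ([x] ++ rs) + e + c * lg N) := by
  obtain ⟨c₁, hc₁, h₁⟩ := hU.exists_extended_chain s
  obtain ⟨c₂, hc₂, h₂⟩ := hU.exists_KC_edge_append_le s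
  obtain ⟨c₃, hc₃, h₃⟩ := hU.exists_KC_edge_rearrange s
  refine ⟨20 * (c₁ + c₂ + c₃ + |t|), by positivity,
    fun n e x y w rs ss N hr hs hN hx hy hxy hi => ?_⟩
  have hl := one_le_lg N
  have p₁ : 0 ≤ c₁ * lg N := by positivity
  have p₂ : 0 ≤ c₂ * lg N := by positivity
  have p₃ : 0 ≤ c₃ * lg N := by positivity
  have p₄ : 0 ≤ |t| * lg N := by positivity
  have ht : t * lg N ≤ |t| * lg N := by gcongr; exact le_abs_self t
  have hx' := abs_le.1 (hx.trans ht)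
  have hy' := abs_le.1 (hy.trans ht)
  have hxy' := abs_le.1 (hxy.trans ht)
  have hi' := abs_le.1 (hi.trans ht)
  obtain ⟨a₁, a₂⟩ := h₁ x y w rs ss N hr hs hN
  obtain ⟨a₃, a₄⟩ := h₁ y x w ss rs N hs hr (by omega)
  obtain ⟨a₅, a₆, a₇⟩ := h₂ x y w rs ss N hr hN
  obtain ⟨b₁, -, b₂, -⟩ := h₃ x y rs ss [] N hr hs
  obtain ⟨-, b₃, -, b₄⟩ := h₃ x y rs ss [w] N hr hs
  simp only [MI, List.append_nil]
  -- In the first inequality C(rx|w,x) + C(ry|w,y) occurs three times against two on the other side;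
  -- the excess is at most C(rx) + C(ry). In the second the terms cancel.
  constructor <;> intro h <;> linarith

end IsOptimal

theorem theorem3 (U : Machine) (hU : IsOptimal U)
    (G : ℕ → BipGraph) (hG : BipGraph.IsExplicit G) (t : ℝ) :
    ∃ c : ℝ, ∀ n q : ℕ, Nat.log 2 q = n → (G n).HasParams q 1 →
      ∀ x y : Str, BipGraph.IsTypicalEdge U t (G n) q 1 x y →
        ((G n).BoundedCommonNbhd 1 →
          ∀ w : Str,
            MI U [w] [x, y] [] ≤
                2 * MI U [w] [x] [y] + 2 * MI U [w] [y] [x] + c * logTerm [w, x, y] ∧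
            ∀ (m : ℕ) (rx ry : Str), rx.length = m → ry.length = m →
              IndepStrings U t x y rx ry →
                MI U [w] [x, y, rx, ry] [] ≤
                  2 * MI U [w] [x, rx] [y, ry] + 2 * MI U [w] [y, ry] [x, rx]
                    + c * logTerm [w, x, y, rx, ry]) ∧
        ((G n).IsGoodExpander →
          ∀ w : Str, (KC U [w] [] : ℝ) ≤ Real.logb 2 q →
            MI U [w] [x, y] [] ≤
                MI U [w] [x] [y] + MI U [w] [y] [x] + c * logTerm [w, x, y] ∧
            ∀ (m : ℕ) (rx ry : Str), rx.length = m → ry.length = m →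
              IndepStrings U t x y rx ry →
                MI U [w] [x, y, rx, ry] [] ≤
                  MI U [w] [x, rx] [y, ry] + MI U [w] [y, ry] [x, rx]
                    + c * logTerm [w, x, y, rx, ry]) := by
  obtain ⟨c₁, hc₁, h₁⟩ := hU.exists_typicalEdge_le hG t
  obtain ⟨c₀, h₀⟩ := hU.exists_KC_nil_le
  -- With empty additional tuples, the independence error is twice the complexity of the empty
  -- tuple, at most `2 * c₀`.
  obtain ⟨c₂, hc₂, h₂⟩ := hU.exists_MI_le 0 (|t| + 2 * c₀)
  obtain ⟨c₃, hc₃, h₃⟩ := hU.exists_MI_le 1 |t|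
  refine ⟨c₁ + c₂ + c₃, fun k q hqk hpar x y htyp => ?_⟩
  have hlog : ∀ (us : List Str) (N : ℕ), totalLength us ≤ N → t * logTerm us ≤ |t| * lg N := by
    intro us N hN
    have h1 : logTerm us ≤ lg N := lg_mono hN
    have h2 : 0 ≤ logTerm us := zero_le_one.trans (one_le_lg _)
    calc t * logTerm us ≤ |t| * logTerm us := by gcongr; exact le_abs_self t
      _ ≤ |t| * lg N := by gcongr
  obtain ⟨hE, hx, hy, hxy⟩ := id htyp
  norm_num only [Nat.cast_one] at hy hxy
  have pair : ∀ (w : Str) (e : ℝ), _ := fun w e =>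
    h₂ (Real.logb 2 q) e x y w [] [] (totalLength [w, x, y]) rfl rfl (by simp)
      (hx.trans ((hlog _ (totalLength [w, x, y]) (by simp)).trans
        (by gcongr; exact zero_le_one.trans (one_le_lg _); simp)))
      (hy.trans ((hlog _ (totalLength [w, x, y]) (by simp)).trans
        (by gcongr; exact zero_le_one.trans (one_le_lg _); simp)))
      (hxy.trans ((hlog _ (totalLength [w, x, y]) (by simp)).trans
        (by gcongr; exact zero_le_one.trans (one_le_lg _); simp)))
      (by
        have h4 : (KC U [] [] : ℝ) ≤ c₀ := by exact_mod_cast h₀ []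
        have hl := one_le_lg (totalLength [w, x, y])
        have h5 : (0 : ℝ) ≤ c₀ := by positivity
        have h6 : (c₀ : ℝ) ≤ c₀ * lg (totalLength [w, x, y]) := le_mul_of_one_le_right h5 hl
        have h7 : 0 ≤ |t| * lg (totalLength [w, x, y]) := by positivity
        simp only [List.append_nil]
        rw [abs_le]
        constructor <;> linarith [(KC U [] []).cast_nonneg (α := ℝ)])
  have quadruple : ∀ (w rx ry : Str) (e : ℝ) (_ : IndepStrings U t x y rx ry), _ :=
    fun w rx ry e hi =>
    h₃ (Real.logb 2 q) e x y w [rx] [ry] (totalLength [w, x, y, rx, ry]) rfl rfl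
      (by simp; omega)
      (hx.trans (hlog _ (totalLength [w, x, y, rx, ry]) (by simp; omega)))
      (hy.trans (hlog _ (totalLength [w, x, y, rx, ry]) (by simp; omega)))
      (hxy.trans (hlog _ (totalLength [w, x, y, rx, ry]) (by simp; omega)))
      (hi.trans (hlog _ (totalLength [w, x, y, rx, ry]) (by simp)))
  have nonneg : ∀ ss : List Str, 0 ≤ c₁ * lg (totalLength ss) ∧ 0 ≤ c₂ * lg (totalLength ss) ∧
      0 ≤ c₃ * lg (totalLength ss) := fun ss => by
    have hl := one_le_lg (totalLength ss)
    exact ⟨by positivity, by positivity, by positivity⟩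
  refine ⟨fun hb w => ⟨?_, fun m rx ry _ _ hi => ?_⟩,
    fun hexp w hw => ⟨?_, fun m rx ry _ _ hi => ?_⟩⟩
  · have a₁ := (h₁ k q x y w (totalLength [w, x, y]) hqk hpar htyp (by simp)).1 hb
    have a₂ := (pair w _).1 a₁
    simp only [List.append_nil] at a₂
    obtain ⟨p₁, p₂, p₃⟩ := nonneg [w, x, y]
    rw [logTerm_eq_lg]
    linarith
  · have a₁ := (h₁ k q x y w (totalLength [w, x, y, rx, ry]) hqk hpar htyp
      (by simp; omega)).1 hb
    have a₂ := (quadruple w rx ry _ hi).1 a₁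
    simp only [List.cons_append, List.nil_append] at a₂
    obtain ⟨p₁, p₂, p₃⟩ := nonneg [w, x, y, rx, ry]
    rw [logTerm_eq_lg]
    linarith
  · have a₁ := (h₁ k q x y w (totalLength [w, x, y]) hqk hpar htyp (by simp)).2 hexp hw
    have a₂ := (pair w _).2 a₁
    simp only [List.append_nil] at a₂
    obtain ⟨p₁, p₂, p₃⟩ := nonneg [w, x, y]
    rw [logTerm_eq_lg]
    linarith
  · have a₁ := (h₁ k q x y w (totalLength [w, x, y, rx, ry]) hqk hpar htyp
      (by simp; omega)).2 hexp hw
    have a₂ := (quadruple w rx ry _ hi).2 a₁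
    simp only [List.cons_append, List.nil_append] at a₂
    obtain ⟨p₁, p₂, p₃⟩ := nonneg [w, x, y, rx, ry]
    rw [logTerm_eq_lg]
    linarith
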